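/- Write $e(x)=e^{2\pi i x}$ and let $\mathbb H$ be the upper half-plane. Let $k\in\mathbb Z$, let $p$ be an odd prime, $N\ge 1$ an integer with $(2p,N)=1$, and $\chi$ a Dirichlet character modulo $N$. A *Jacobi form* of weight $k$, index $p$ and nebentypus $\chi$ for $\Gamma_0(N)$ is a holomorphic function $\phi:\mathbb H\times\mathbb C\to\mathbb C$ such that, with $$(\phi|_{k,p}g)(\tau,z)=\phi\Big(\tfrac{a\tau+b}{c\tau+d},\tfrac{z}{c\tau+d}\Big)(c\tau+d)^{-k}e\Big(\tfrac{-pcz^2}{c\tau+d}\Big),\qquad g=\begin{pmatrix}a&b\\c&d\end{pmatrix},$$ (1) $\phi|_{k,p}g=\chi(d)\phi$ for all $g\in\Gamma_0(N)$; (2) $\phi(\tau,z+x\tau+y)=e(-p(x^2\tau+2xz))\phi(\tau,z)$ for all $x,y\in\mathbb Z$; (3) for every $g\in \mathrm{SL}_2(\mathbb Z)$ there is an expansion $\phi|_{k,p}g=\sum_{n\in\frac1N\mathbb Z_{\ge0}}\sum_{r\in\mathbb Z}c(n,r)e(n\tau+rz)$ in which $c(n,r)\ne0$ implies $r^2\le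 4pn$. It is *cuspidal* if for every $g$ moreover $c(n,r)\neq 0$ implies $r^2<4pn$. For $M$ divisible by $4$, $\kappa$ odd and $\psi$ a Dirichlet character modulo $M$, $M_{\kappa/2}(\Gamma_0(M),\psi)$ denotes the space of holomorphic $f:\mathbb H\to\mathbb C$ that are holomorphic at every cusp and satisfy $j(g,\tau)^{-\kappa}f(g\tau)=\psi(d)f(\tau)$ for all $g\in\Gamma_0(M)$. Here $j(g,\tau)=\left(\frac cd\right)\epsilon_d^{-1}\sqrt{c\tau+d}$, with the extended quadratic symbol, the principal square root, and $\epsilon_d=1$ or $i$ according as $d\equiv1$ or $-1$ modulo $4$. Such an $f$ is a cusp form if it vanishes at every cusp. **Proposition.** Let $\phi$ be a nonzero Jacobi form of weight $k$, index $p$ and nebentypus $\chi$ for $\Gamma_0(N)$. There are unique functions $h_\mu:\mathbb H\to\mathbb C$ with $$\phi(\tau,z)=\sum_{\mu\in\mathbb Z/2p\mathbb Z}h_\mu(\tau)\Theta_\mu(\tau,z),\qquad \Theta_\mu(\tau,z)=\sum_{\ell\in\mathbb Z}e\Big(p\big((\ell+\tfrac{\mu}{2p})^2\tau+2(\ell+\tfrac{\mu}{2p})z\big)\Big).$$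 Let $\varepsilon$ be a primitive Dirichlet character of conductor $\mathfrak f_\varepsilon\in\{1,p\}$, and put $h_\varepsilon(\tau)=\sum_{\mu\in\mathbb Z/2p\mathbb Z}\varepsilon(\mu)h_\mu(4p\tau)$. Then $$h_\varepsilon\in M_{k-1/2}\big(\Gamma_0(4pN\mathfrak f_\varepsilon),\varepsilon\chi\chi_p^{-1}\big),$$ where $\chi_p$ is the Dirichlet character modulo $4p$ given by $\chi_p(d)=\left(\frac{-1}{d}\right)^k$ for $d$ coprime to $4p$. If $\phi$ is cuspidal, then $h_\varepsilon$ is a cusp form. Moreover, $h_\varepsilon\neq0$ if and only if $\varepsilon(-1)=\chi(-1)(-1)^k$. -/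

import Mathlib

open scoped UpperHalfPlane MatrixGroups Manifold

noncomputable section

namespace EichlerZagier

/-- `e(x) = exp(2 π i x)`. -/
def e (x : ℂ) : ℂ := Complex.exp (2 * Real.pi * Complex.I * x)

/-! ### Modular forms of half-integral weight -/

/-- The quadratic symbol `(c/d)` for odd `d`, extended to negative `d` as by Shimura and Koblitz:
it is the Jacobi symbol `(c/|d|)`, with an additional sign `-1` when `c` and `d` are both negative.
In particular the value at `c = 0` is `1` for `d = 1` and `d = -1`. -/
def quadSymbol (c d : ℤ) : ℤ :=
  (if c < 0 ∧ d < 0 then -1 else 1) * jacobiSym c d.natAbs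

/-- For odd `d`: `1` if `d ≡ 1 mod 4`, and `i` if `d ≡ -1 mod 4`. -/
def epsD (d : ℤ) : ℂ := if d % 4 = 1 then 1 else Complex.I

/-- The principal square root of `c τ + d`. -/
def sqrtDenom (γ : SL(2, ℤ)) (τ : ℍ) : ℂ :=
  ((γ 1 0 : ℂ) * (τ : ℂ) + (γ 1 1 : ℂ)) ^ (1 / 2 : ℂ)

/-- The theta automorphy factor `j(γ, τ) = (c/d) ε_d⁻¹ √(c τ + d)`, for `γ ∈ Γ₀(4)`. -/
def thetaJ (γ : SL(2, ℤ)) (τ : ℍ) : ℂ :=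
  (quadSymbol (γ 1 0) (γ 1 1) : ℂ) * (epsD (γ 1 1))⁻¹ * sqrtDenom γ τ

/-- `f` is a modular form of weight `κ / 2` on `Γ₀(M)` with nebentypus `ψ`
(`κ` an odd integer, `M` a positive multiple of `4`).
Holomorphy at the cusp `γ ∞` means that `(c τ + d) ^ (-κ / 2) f (γ τ)` is bounded at `i ∞`. -/
structure IsHalfIntegralModularForm (κ : ℤ) (M : ℕ) (ψ : DirichletCharacter ℂ M)
    (f : ℍ → ℂ) : Prop where
  holomorphic : MDifferentiable 𝓘(ℂ) 𝓘(ℂ) f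
  slash_eq : ∀ γ ∈ CongruenceSubgroup.Gamma0 M, ∀ τ : ℍ,
    (thetaJ γ τ) ^ (-κ) * f (γ • τ) = ψ ((γ 1 1 : ℤ) : ZMod M) * f τ
  bounded_at_cusps : ∀ γ : SL(2, ℤ),
    UpperHalfPlane.IsBoundedAtImInfty (fun τ : ℍ => (sqrtDenom γ τ) ^ (-κ) * f (γ • τ))

/-- A modular form of weight `κ / 2` that vanishes at every cusp. -/
structure IsHalfIntegralCuspForm (κ : ℤ) (M : ℕ) (ψ : DirichletCharacter ℂ M)
    (f : ℍ → ℂ) : Prop extends IsHalfIntegralModularForm κ M ψ f where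
  zero_at_cusps : ∀ γ : SL(2, ℤ),
    UpperHalfPlane.IsZeroAtImInfty (fun τ : ℍ => (sqrtDenom γ τ) ^ (-κ) * f (γ • τ))

/-! ### Jacobi forms of scalar index -/

/-- The slash operator of weight `k` and index `m`:
`(φ | γ)(τ, z) = φ(γ τ, z / (c τ + d)) (c τ + d) ^ (-k) e(-m c z² / (c τ + d))`. -/
def jacobiSlash (k : ℤ) (m : ℕ) (φ : ℍ → ℂ → ℂ) (γ : SL(2, ℤ)) (τ : ℍ) (z : ℂ) : ℂ :=
  φ (γ • τ) (z / ((γ 1 0 : ℂ) * (τ : ℂ) + (γ 1 1 : ℂ))) *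
    ((γ 1 0 : ℂ) * (τ : ℂ) + (γ 1 1 : ℂ)) ^ (-k) *
    e (-(m : ℂ) * (γ 1 0 : ℂ) * z ^ 2 / ((γ 1 0 : ℂ) * (τ : ℂ) + (γ 1 1 : ℂ)))

/-- `F(τ, z) = ∑ c(n, r) e(n τ / N) e(r z)`, over integers `n ≥ 0` and `r`. The exponents of
`q = e(τ)` lie in `(1/N) ℤ`, as they do at a general cusp of `Γ₀(N)`. -/
def HasJacobiExpansion (N : ℕ) (F : ℍ → ℂ → ℂ) (c : ℕ → ℤ → ℂ) : Prop :=
  ∀ (τ : ℍ) (z : ℂ),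
    HasSum (fun x : ℕ × ℤ => c x.1 x.2 * e ((x.1 : ℂ) / (N : ℂ) * (τ : ℂ)) * e ((x.2 : ℂ) * z))
      (F τ z)

/-- `φ` is a Jacobi form of weight `k`, index `m > 0` and nebentypus `χ` for `Γ₀(N)`. In the
expansion at each cusp the coefficient of `e((n / N) τ + r z)` is supported on the pairs for which
the matrix with rows `(n / N, r / 2)`, `(r / 2, m)` is positive semidefinite, that is
`r² ≤ 4 m (n / N)`. -/
structure IsJacobiForm (k : ℤ) (m N : ℕ) (χ : DirichletCharacter ℂ N)
    (φ : ℍ → ℂ → ℂ) : Prop where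
  holomorphic : DifferentiableOn ℂ
    (fun w : ℂ × ℂ => φ (UpperHalfPlane.ofComplex w.1) w.2) {w : ℂ × ℂ | 0 < w.1.im}
  slash_eq : ∀ γ ∈ CongruenceSubgroup.Gamma0 N, ∀ (τ : ℍ) (z : ℂ),
    jacobiSlash k m φ γ τ z = χ ((γ 1 1 : ℤ) : ZMod N) * φ τ z
  elliptic : ∀ (x y : ℤ) (τ : ℍ) (z : ℂ),
    φ τ (z + (x : ℂ) * (τ : ℂ) + (y : ℂ)) =
      e (-(m : ℂ) * ((x : ℂ) ^ 2 * (τ : ℂ) + 2 * (x : ℂ) * z)) * φ τ z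
  expansion : ∀ γ : SL(2, ℤ), ∃ c : ℕ → ℤ → ℂ,
    HasJacobiExpansion N (jacobiSlash k m φ γ) c ∧
      ∀ (n : ℕ) (r : ℤ), c n r ≠ 0 → (N : ℤ) * r ^ 2 ≤ 4 * (m : ℤ) * (n : ℤ)

/-- A Jacobi form is cuspidal if at every cusp the expansion is supported on the pairs for which
the matrix with rows `(n / N, r / 2)`, `(r / 2, m)` is positive definite. -/
structure IsJacobiCuspForm (k : ℤ) (m N : ℕ) (χ : DirichletCharacter ℂ N)
    (φ : ℍ → ℂ → ℂ) : Prop extends IsJacobiForm k m N χ φ where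
  cusp_expansion : ∀ γ : SL(2, ℤ), ∃ c : ℕ → ℤ → ℂ,
    HasJacobiExpansion N (jacobiSlash k m φ γ) c ∧
      ∀ (n : ℕ) (r : ℤ), c n r ≠ 0 → (N : ℤ) * r ^ 2 < 4 * (m : ℤ) * (n : ℤ)

/-! ### Theta decomposition and the twisted Eichler–Zagier map -/

/-- `Θ_μ(τ, z) = ∑_{ℓ ∈ ℤ} e(m ((ℓ + μ̃)² τ + 2 (ℓ + μ̃) z))` with `μ̃ = μ / (2 m)`; the choice of
the representative of `μ` modulo `2 m` does not matter. -/
def jacobiTheta (m : ℕ) (μ : ZMod (2 * m)) (τ : ℍ) (z : ℂ) : ℂ :=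
  ∑' l : ℤ, e ((m : ℂ) *
    (((l : ℂ) + (μ.val : ℂ) / (2 * (m : ℂ))) ^ 2 * (τ : ℂ) +
      2 * ((l : ℂ) + (μ.val : ℂ) / (2 * (m : ℂ))) * z))

/-- The functions `h_μ` are the theta components of `φ`:
`φ(τ, z) = ∑_{μ mod 2 m} h_μ(τ) Θ_μ(τ, z)`. -/
def IsThetaDecomposition (m : ℕ) [NeZero m] (φ : ℍ → ℂ → ℂ) (h : ZMod (2 * m) → ℍ → ℂ) : Prop :=
  ∀ (τ : ℍ) (z : ℂ), φ τ z = ∑ μ : ZMod (2 * m), h μ τ * jacobiTheta m μ τ z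

/-- The point `4 m τ` of the upper half-plane. -/
def scale (m : ℕ) [NeZero m] (τ : ℍ) : ℍ :=
  ⟨4 * (m : ℂ) * (τ : ℂ), by
    have hm : (0 : ℝ) < m := Nat.cast_pos.mpr (Nat.pos_of_ne_zero (NeZero.ne m))
    have h4 : (4 * (m : ℂ) * (τ : ℂ)).im = 4 * (m : ℝ) * τ.im := by
      simp [Complex.mul_im]
    rw [h4]
    exact mul_pos (mul_pos (by norm_num) hm) τ.im_pos⟩

/-- `h_ε(τ) = ∑_{μ mod 2 m} ε(μ) h_μ(4 m τ)`, for a character `ε` whose modulus `f` divides `2 m`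
(so that `ε(μ)` makes sense). -/
def twistedEZ (m : ℕ) [NeZero m] {f : ℕ} (ε : DirichletCharacter ℂ f)
    (h : ZMod (2 * m) → ℍ → ℂ) (τ : ℍ) : ℂ :=
  ∑ μ : ZMod (2 * m), ε (μ.cast : ZMod f) * h μ (scale m τ)

/-- The character modulo `4 p` given by `d ↦ (-1/d)^k`, i.e. the `k`-th power of the nontrivial
character modulo `4`, viewed modulo `4 p`. -/
def chiP (k : ℤ) (p : ℕ) : DirichletCharacter ℂ (4 * p) :=
  (DirichletCharacter.changeLevel (Dvd.intro p rfl : 4 ∣ 4 * p)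
    (ZMod.χ₄.ringHomComp (Int.castRingHom ℂ) : DirichletCharacter ℂ 4)) ^ k

/-- The product `ε χ χ_p⁻¹` as a Dirichlet character modulo `4 p N f`, for `ε` modulo `f` and
`χ` modulo `N`. -/
def nebentypus (k : ℤ) (p : ℕ) {N f : ℕ} (χ : DirichletCharacter ℂ N)
    (ε : DirichletCharacter ℂ f) : DirichletCharacter ℂ (4 * p * N * f) :=
  DirichletCharacter.changeLevel (Dvd.intro_left (4 * p * N) rfl : f ∣ 4 * p * N * f) ε *
  DirichletCharacter.changeLevel
    ((Dvd.intro_left (4 * p) rfl : N ∣ 4 * p * N).mul_right f) χ *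
  (DirichletCharacter.changeLevel
    ((Dvd.intro N rfl : 4 * p ∣ 4 * p * N).mul_right f) (chiP k p))⁻¹

end EichlerZagier

end

namespace EichlerZagier

open Complex

/-! ### The exponential `e` -/

/-! The elliptic law makes the `r`-th Fourier coefficient of `φ(τ, ·)`, divided by `e(r²τ/4p)`,
depend only on `r` modulo `2p`; this is the theta decomposition. It is unique because Fourier
coefficients are (`exists_thetaDecomposition`, `jacobiTheta_coeff_unique`).

For the transformation law, `∑ ε(μ) Θ_μ(4pτ, z) = ∑ ε(r) e(r²τ + rz)` no longer involves the index,
and is a finite Fourier combination of translates of one theta function `θ(τ, z)`. The law of `θ` on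
`Γ₀(4)` with its exact multiplier (`thetaLaw`) follows from a Euclidean descent and yields the law
of the twisted series on `Γ₀(4f²)` (`twistedTheta_smul`). On the other hand `SL(2, ℤ)` acts on the
vector `(Θ_μ)` by unitary matrices, up to a square root of `cτ + d` (`actsUnitarily`). Hence the
values of `ε⁻¹` form a left eigenvector of the matrix concerned, and by unitarity those of `ε` form
a right eigenvector (`char_eigenvector`). The components `h_μ` transform dually to the `Θ_μ`, so
pairing them with this eigenvector gives the law of `h_ε`; `j² = (-1/d)(cτ + d)` accounts for the
weight and for `χ_p`.

At a cusp, unitarity bounds the `h_μ` by the components of `φ|γ`, which are `q`-series with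
nonnegative exponents, bounded away from `0` in the cuspidal case.

For nonvanishing, `-1 ∈ Γ₀(N)` gives `h_{-μ} = χ(-1)(-1)^k h_μ`, so `h_ε = 0` if the parities
differ. If they agree and `h_ε = 0`, translations `τ ↦ τ + n` separate the classes of `μ²` modulo
`4p`. For an odd prime `p` such a class is `{μ, -μ}`, so `h_μ = 0` for all `μ` prime to `p`. Then
the components of `φ|S` have period `2` in the index, which is incompatible with the invariance of
`φ|S` under `T^N` as `p ∤ N` (`eq_zero_of_component_eq_zero`); so `φ = 0`. -/

lemma e_add (x y : ℂ) : e (x + y) = e x * e y := by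
  simp only [e, mul_add, Complex.exp_add]

lemma e_ne_zero (x : ℂ) : e x ≠ 0 := Complex.exp_ne_zero _

@[simp] lemma e_zero : e 0 = 1 := by simp [e]

lemma e_neg (x : ℂ) : e (-x) = (e x)⁻¹ := by
  simp only [e, mul_neg, Complex.exp_neg]

@[simp] lemma e_int (n : ℤ) : e n = 1 := by
  rw [e, Complex.exp_eq_one_iff]
  exact ⟨n, by ring⟩

lemma e_eq_one_iff (x : ℂ) : e x = 1 ↔ ∃ n : ℤ, x = n := by
  rw [e, Complex.exp_eq_one_iff]
  have h2 : (2 * Real.pi * I : ℂ) ≠ 0 := by simp [Real.pi_ne_zero]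
  refine exists_congr fun n => ?_
  rw [mul_comm (n : ℂ), mul_right_inj' h2]

lemma e_eq_of_sub {x y : ℂ} (n : ℤ) (h : x = y + n) : e x = e y := by
  rw [h, e_add, e_int, mul_one]

lemma norm_e (x : ℂ) : ‖e x‖ = Real.exp (-(2 * Real.pi * x.im)) := by
  rw [e, Complex.norm_exp]
  simp

/-! ### The quadratic symbol -/

/-- Write `c = 4c'`. The factor `4` is a square and drops out, and `(c'/b)` has period `4|c'| = |c|`
in `b` by reciprocity. -/
lemma jacobiSym_eq_of_modEq {c : ℤ} (hc : (4 : ℤ) ∣ c) {b₁ b₂ : ℕ} (h₁ : Odd b₁) (h₂ : Odd b₂)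
    (h : (b₁ : ℤ) ≡ b₂ [ZMOD c]) : jacobiSym c b₁ = jacobiSym c b₂ := by
  obtain ⟨c', rfl⟩ := hc
  have h4 : ∀ b : ℕ, Odd b → jacobiSym (4 * c') b = jacobiSym c' b := fun b hb => by
    rw [jacobiSym.mul_left, jacobiSym.at_four hb, one_mul]
  rw [h4 _ h₁, h4 _ h₂, jacobiSym.mod_right c' h₁, jacobiSym.mod_right c' h₂]
  congr 1
  have h' : (b₁ : ℤ) ≡ b₂ [ZMOD ((4 * c'.natAbs : ℕ) : ℤ)] := by
    refine Int.ModEq.of_dvd ?_ h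
    push_cast
    exact mul_dvd_mul_left _ (by simp)
  exact (Int.natCast_modEq_iff.mp h')

/-- Since `|c| ≡ 1` modulo `|c| - 1`, only the sign of `c` matters, and `|c| - 1 ≡ 3` modulo `4`. -/
lemma jacobiSym_natAbs_sub_one {c : ℤ} (hc : (4 : ℤ) ∣ c) (h0 : c ≠ 0) :
    jacobiSym c (c.natAbs - 1) = if c < 0 then -1 else 1 := by
  have hpos : ∀ n : ℕ, 4 ∣ n → n ≠ 0 → jacobiSym (n : ℤ) (n - 1) = 1 := by
    intro n hn hn0
    rw [jacobiSym.mod_left' (a₂ := 1), jacobiSym.one_left]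
    refine Int.ModEq.symm ?_
    rw [Int.modEq_iff_dvd]
    have : 1 ≤ n := by omega
    push_cast [this]
    exact dvd_refl _
  have h4 : 4 ∣ c.natAbs := by simpa using! Int.natAbs_dvd_natAbs.mpr hc
  have hn0 : c.natAbs ≠ 0 := by simpa
  have hodd : Odd (c.natAbs - 1) := by
    rw [Nat.odd_iff]; omega
  split_ifs with h
  · have : c = -(c.natAbs : ℤ) := by omega
    rw [this, jacobiSym.neg _ (by rw [Int.natAbs_neg, Int.natAbs_natCast]; exact hodd)]
    rw [Int.natAbs_neg, Int.natAbs_natCast, hpos _ h4 hn0, mul_one,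
      ZMod.χ₄_nat_three_mod_four (by omega)]
  · have : c = (c.natAbs : ℤ) := by omega
    rw [this, Int.natAbs_natCast]
    exact hpos _ h4 hn0

/-- The positive number `|c| - 1` stands in for `-1` modulo `c`: from `b₂ b₁ ≡ b₁² (|c| - 1)` one
may cancel the square. -/
lemma jacobiSym_of_modEq_neg {c : ℤ} (hc : (4 : ℤ) ∣ c) (h0 : c ≠ 0) {b₁ b₂ : ℕ} (h₁ : Odd b₁)
    (h₂ : Odd b₂) (hb : IsCoprime c b₁) (h : (b₂ : ℤ) ≡ -b₁ [ZMOD c]) :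
    jacobiSym c b₂ = (if c < 0 then -1 else 1) * jacobiSym c b₁ := by
  have hn4 : 4 ∣ c.natAbs := by simpa using! Int.natAbs_dvd_natAbs.mpr hc
  have hn0 : c.natAbs ≠ 0 := by simpa
  have hodd : Odd (c.natAbs - 1) := by
    rw [Nat.odd_iff]; omega
  have hb1 : b₁ ≠ 0 := by rintro rfl; simp at h₁
  have hb2 : b₂ ≠ 0 := by rintro rfl; simp at h₂
  have hm : ((c.natAbs - 1 : ℕ) : ℤ) ≡ -1 [ZMOD c] := by
    have : 1 ≤ c.natAbs := by omega
    push_cast [this]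
    rw [Int.modEq_iff_dvd]
    rw [show -1 - (|c| - 1) = -|c| by ring]
    simp
  have hsq : jacobiSym c b₁ * jacobiSym c b₁ = 1 := by
    rw [← sq]
    exact jacobiSym.sq_one (Int.isCoprime_iff_gcd_eq_one.mp hb)
  have key : jacobiSym c (b₂ * b₁) = jacobiSym c ((b₁ * b₁) * (c.natAbs - 1)) := by
    refine jacobiSym_eq_of_modEq hc (h₂.mul h₁) ((h₁.mul h₁).mul hodd) ?_
    push_cast only [Nat.cast_mul]
    calc (b₂ : ℤ) * b₁ ≡ -b₁ * b₁ [ZMOD c] := h.mul_right _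
      _ = b₁ * b₁ * (-1) := by ring
      _ ≡ _ [ZMOD c] := hm.symm.mul_left _
  rw [jacobiSym.mul_right' _ hb2 hb1, jacobiSym.mul_right' _ (mul_ne_zero hb1 hb1)
    (by rintro h; simp [h] at hodd), jacobiSym.mul_right' _ hb1 hb1, hsq, one_mul,
    jacobiSym_natAbs_sub_one hc h0] at key
  calc jacobiSym c b₂ = jacobiSym c b₂ * (jacobiSym c b₁ * jacobiSym c b₁) := by rw [hsq, mul_one]
    _ = _ := by rw [← mul_assoc, key]

/-- If `d` and `d + nc` have opposite signs, their absolute values are negatives of each other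
modulo `c`. The sign this costs for `c < 0` is exactly the extra sign in the extended symbol. -/
lemma quadSymbol_add_mul {c d : ℤ} (hc : (4 : ℤ) ∣ c) (h0 : c ≠ 0) (hcd : IsCoprime c d) (n : ℤ) :
    quadSymbol c (d + n * c) = quadSymbol c d := by
  have hodd : ∀ d : ℤ, IsCoprime c d → Odd d.natAbs := by
    intro d hcd
    rw [Int.natAbs_odd, ← Int.not_even_iff_odd, even_iff_two_dvd]
    intro h2
    have : IsUnit (2 : ℤ) := hcd.isUnit_of_dvd' ((by norm_num : (2 : ℤ) ∣ 4).trans hc) h2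
    exact absurd this (by decide)
  have hcd' : IsCoprime c (d + n * c) := by
    rw [mul_comm]; exact IsCoprime.add_mul_left_right hcd n
  have ho := hodd d hcd
  have ho' := hodd _ hcd'
  set d' := d + n * c with hd'
  have hmod : d' ≡ d [ZMOD c] := by
    rw [Int.modEq_iff_dvd, hd']; exact ⟨-n, by ring⟩
  have hd0 : d ≠ 0 := by rintro rfl; simp at ho
  have hd0' : d' ≠ 0 := by intro h; simp [h] at ho'
  have hdn : (d.natAbs : ℤ) = |d| := by simp
  have hdn' : (d'.natAbs : ℤ) = |d'| := by simp
  have hcn : IsCoprime c (d.natAbs : ℤ) := by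
    rcases abs_choice d with h | h <;> rw [hdn, h]
    · exact hcd
    · exact hcd.neg_right
  rcases lt_or_gt_of_ne hd0 with h | h <;> rcases lt_or_gt_of_ne hd0' with h' | h'
  · unfold quadSymbol
    rw [jacobiSym_eq_of_modEq hc ho' ho
      (by rw [hdn, hdn', abs_of_neg h, abs_of_neg h']; exact hmod.neg)]
    simp [h, h']
  · unfold quadSymbol
    rw [jacobiSym_of_modEq_neg hc h0 ho ho' hcn
      (by rw [hdn, hdn', abs_of_neg h, abs_of_pos h', neg_neg]; exact hmod)]
    simp [h, h'.not_gt]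
  · unfold quadSymbol
    rw [jacobiSym_of_modEq_neg hc h0 ho ho' hcn
      (by rw [hdn, hdn', abs_of_neg h', abs_of_pos h]; exact hmod.neg)]
    simp only [h', h.not_gt, and_true, and_false, if_false, one_mul]
    split_ifs <;> simp
  · unfold quadSymbol
    rw [jacobiSym_eq_of_modEq hc ho' ho
      (by rw [hdn, hdn', abs_of_pos h, abs_of_pos h']; exact hmod)]
    simp [h.not_gt, h'.not_gt]

lemma quadSymbol_add_mul_left {c d : ℤ} (hd : 0 < d) (n : ℤ) :
    quadSymbol (c + n * d) d = quadSymbol c d := by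
  unfold quadSymbol
  rw [jacobiSym.mod_left' (a₁ := c + n * d) (a₂ := c)]
  · simp [hd.not_gt]
  · rw [show (d.natAbs : ℤ) = d by omega]
    simp

/-- The factor `(c/d) ε_d⁻¹` of the theta automorphy factor. -/
noncomputable def thetaSign (c d : ℤ) : ℂ := (quadSymbol c d : ℂ) * (epsD d)⁻¹

lemma thetaSign_add_mul {c d : ℤ} (hc : (4 : ℤ) ∣ c) (h0 : c ≠ 0) (hcd : IsCoprime c d) (n : ℤ) :
    thetaSign c (d + n * c) = thetaSign c d := by
  unfold thetaSign epsD
  rw [quadSymbol_add_mul hc h0 hcd]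
  have : (d + n * c) % 4 = d % 4 := by
    obtain ⟨c', rfl⟩ := hc
    rw [show d + n * (4 * c') = d + 4 * (n * c') by ring]
    simp
  rw [this]

lemma thetaSign_neg_of_pos {c d : ℤ} (hc : (4 : ℤ) ∣ c) (hcd : IsCoprime c d) (hd : 0 < d) :
    thetaSign (-c) (-d) = (if 0 < c then I else -I) * thetaSign c d := by
  have hodd : Odd d := by
    rw [← Int.not_even_iff_odd, even_iff_two_dvd]
    intro h2
    have : IsUnit (2 : ℤ) := hcd.isUnit_of_dvd' ((by norm_num : (2 : ℤ) ∣ 4).trans hc) h2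
    exact absurd this (by decide)
  have hodd' : Odd d.natAbs := by rwa [Int.natAbs_odd]
  unfold thetaSign quadSymbol epsD
  rw [Int.natAbs_neg, jacobiSym.neg _ hodd']
  have hd2 := Int.odd_iff.mp hodd
  have hd' : ¬ d < 0 := hd.not_gt
  rcases (by omega : d % 4 = 1 ∨ d % 4 = 3) with h | h
  · rw [ZMod.χ₄_nat_one_mod_four (by omega), if_neg (by omega : ¬ (-d) % 4 = 1), if_pos h]
    by_cases h' : 0 < c
    · simp [h', hd, hd', mul_comm]
    · simp [h', hd', mul_comm]
  · rw [ZMod.χ₄_nat_three_mod_four (by omega), if_pos (by omega : (-d) % 4 = 1),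
      if_neg (by omega : ¬ d % 4 = 1)]
    by_cases h' : 0 < c
    · simp [h', hd, hd', ← mul_assoc, mul_right_comm I]
    · simp [h', hd', ← mul_assoc, mul_right_comm I]

/-! ### The principal square root -/

lemma sq_cpow_half {w : ℂ} (hw : 0 < w.re) : (w ^ 2) ^ (1 / 2 : ℂ) = w := by
  have h := abs_lt.mp (Complex.abs_arg_lt_pi_div_two_iff.mpr (Or.inl hw))
  have := Complex.pow_cpow_nat_inv (x := w) (n := 2) (by norm_num)
    (by push_cast; exact h.1) (by push_cast; exact h.2.le)
  simpa using this

lemma cpow_half_sq (z : ℂ) : (z ^ (1 / 2 : ℂ)) ^ 2 = z := by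
  rw [one_div]
  exact_mod_cast Complex.cpow_nat_inv_pow z (n := 2) (by norm_num)

lemma cpow_half_re_pos {z : ℂ} (hz : z ∈ Complex.slitPlane) : 0 < (z ^ (1 / 2 : ℂ)).re := by
  have hz0 := Complex.slitPlane_ne_zero hz
  have h := (Complex.mem_slitPlane_iff_arg.mp hz).1
  rw [Complex.cpow_def_of_ne_zero hz0, Complex.exp_re]
  refine mul_pos (Real.exp_pos _) (Real.cos_pos_of_mem_Ioo ?_)
  have him : (Complex.log z * (1 / 2)).im = z.arg / 2 := by
    rw [show (1 / 2 : ℂ) = ((1 / 2 : ℝ) : ℂ) by norm_num, Complex.im_mul_ofReal, Complex.log_im]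
    ring
  rw [him]
  have h1 := Complex.neg_pi_lt_arg z
  have h2 := Complex.arg_le_pi z
  have h3 := lt_of_le_of_ne h2 h
  constructor <;> linarith

lemma cpow_half_ne_zero {z : ℂ} (hz : z ≠ 0) : z ^ (1 / 2 : ℂ) ≠ 0 := by
  simp [Complex.cpow_eq_zero_iff, hz]

/-- The principal square root is compatible with division in the right half plane. -/
lemma cpow_half_div {z₁ z₂ : ℂ} (h₁ : 0 < z₁.re) (h₂ : 0 < z₂.re) :
    (z₁ / z₂) ^ (1 / 2 : ℂ) = z₁ ^ (1 / 2 : ℂ) / z₂ ^ (1 / 2 : ℂ) := by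
  have r₁ := cpow_half_re_pos (Complex.mem_slitPlane_iff.mpr (Or.inl h₁))
  have r₂ := cpow_half_re_pos (Complex.mem_slitPlane_iff.mpr (Or.inl h₂))
  have s₁ := cpow_half_sq z₁
  have s₂ := cpow_half_sq z₂
  generalize z₁ ^ (1 / 2 : ℂ) = u at *
  generalize z₂ ^ (1 / 2 : ℂ) = v at *
  rw [← s₁, sq, Complex.mul_re] at h₁
  rw [← s₂, sq, Complex.mul_re] at h₂
  rw [← s₁, ← s₂, ← div_pow]
  -- Both roots have argument in `(-π/4, π/4)`, that is `|im| < re`, so their quotient lies in the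
  -- right half plane.
  refine sq_cpow_half ?_
  rw [Complex.div_re, ← add_div]
  have hv : v ≠ 0 := by rintro rfl; simp at r₂
  refine div_pos ?_ (Complex.normSq_pos.mpr hv)
  have a₁ := abs_lt_of_sq_lt_sq (by linarith : u.im ^ 2 < u.re ^ 2) r₁.le
  have a₂ := abs_lt_of_sq_lt_sq (by linarith : v.im ^ 2 < v.re ^ 2) r₂.le
  have : |u.im * v.im| < u.re * v.re := by
    rw [abs_mul]; exact mul_lt_mul'' a₁ a₂ (abs_nonneg _) (abs_nonneg _)
  linarith [neg_abs_le (u.im * v.im)]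

lemma im_eq_of_sq_cpow_half (z : ℂ) :
    z.im = 2 * (z ^ (1 / 2 : ℂ)).re * (z ^ (1 / 2 : ℂ)).im := by
  conv_lhs => rw [← cpow_half_sq z]
  rw [sq, Complex.mul_im]; ring

/-- The principal square root is multiplicative on `z₁`, `z₂` in the slit plane if it has no
reason not to be: the product is in the slit plane, and when both are on the same side of the real
axis then so is the product. -/
lemma cpow_half_mul {z₁ z₂ : ℂ} (h₁ : z₁ ∈ Complex.slitPlane) (h₂ : z₂ ∈ Complex.slitPlane)
    (h : z₁ * z₂ ∈ Complex.slitPlane) (hpos : 0 < z₁.im → 0 < z₂.im → 0 < (z₁ * z₂).im)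
    (hneg : z₁.im < 0 → z₂.im < 0 → (z₁ * z₂).im < 0) :
    (z₁ * z₂) ^ (1 / 2 : ℂ) = z₁ ^ (1 / 2 : ℂ) * z₂ ^ (1 / 2 : ℂ) := by
  have r₁ := cpow_half_re_pos h₁
  have r₂ := cpow_half_re_pos h₂
  have i₁ := im_eq_of_sq_cpow_half z₁
  have i₂ := im_eq_of_sq_cpow_half z₂
  have hsq : (z₁ ^ (1 / 2 : ℂ) * z₂ ^ (1 / 2 : ℂ)) ^ 2 = z₁ * z₂ := by
    rw [mul_pow, cpow_half_sq, cpow_half_sq]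
  generalize z₁ ^ (1 / 2 : ℂ) = w₁ at *
  generalize z₂ ^ (1 / 2 : ℂ) = w₂ at *
  suffices hre : 0 < (w₁ * w₂).re by
    rw [← hsq]; exact sq_cpow_half hre
  by_contra! hle
  have hne : (w₁ * w₂).re ≠ 0 := by
    intro h0
    rw [← hsq, Complex.mem_slitPlane_iff] at h
    rw [sq, Complex.mul_re (w₁ * w₂), Complex.mul_im (w₁ * w₂), h0] at h
    rcases h with h | h
    · nlinarith [sq_nonneg (w₁ * w₂).im]
    · simp at h
  have hlt := lt_of_le_of_ne hle hne
  have him : (z₁ * z₂).im = 2 * (w₁ * w₂).re * (w₁ * w₂).im := by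
    rw [← hsq, sq, Complex.mul_im (w₁ * w₂)]; ring
  rw [Complex.mul_re] at hlt
  -- A negative real part of `w₁ w₂` forces `w₁`, `w₂` to the same side of the real axis; `z₁ z₂`
  -- then lies on the opposite side, against `hpos` or `hneg`.
  have hii : 0 < w₁.im * w₂.im := by nlinarith [mul_pos r₁ r₂]
  rcases (mul_pos_iff.mp hii) with ⟨a, b⟩ | ⟨a, b⟩
  · have := hpos (by rw [i₁]; positivity) (by rw [i₂]; positivity)
    rw [him, Complex.mul_re, Complex.mul_im] at this
    have hh : 0 < w₁.re * w₂.im + w₁.im * w₂.re := by positivity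
    nlinarith
  · have := hneg (by rw [i₁]; nlinarith) (by rw [i₂]; nlinarith)
    rw [him, Complex.mul_re, Complex.mul_im] at this
    have hh : w₁.re * w₂.im + w₁.im * w₂.re < 0 := by nlinarith
    nlinarith

lemma cpow_half_neg_of_im_pos {z : ℂ} (hz : 0 < z.im) :
    (-z) ^ (1 / 2 : ℂ) = -I * z ^ (1 / 2 : ℂ) := by
  have r := cpow_half_re_pos (Complex.mem_slitPlane_iff.mpr (Or.inr hz.ne'))
  have i := im_eq_of_sq_cpow_half z
  rw [← sq_cpow_half (w := -I * z ^ (1 / 2 : ℂ))]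
  · rw [mul_pow, cpow_half_sq]; simp
  · simp
    have : 0 < 2 * (z ^ (1 / 2 : ℂ)).re * (z ^ (1 / 2 : ℂ)).im := i ▸ hz
    have := pos_of_mul_pos_right this (by positivity)
    simpa only [one_div] using this

lemma cpow_half_neg_of_im_neg {z : ℂ} (hz : z.im < 0) :
    (-z) ^ (1 / 2 : ℂ) = I * z ^ (1 / 2 : ℂ) := by
  have := cpow_half_neg_of_im_pos (z := -z) (by simpa using hz)
  rw [neg_neg] at this
  rw [this, ← mul_assoc]; simp

end EichlerZagier

namespace EichlerZagier

open Complex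

/-! ### The theta function of two variables on `Γ₀(4)` -/

/-- `θ(τ, z) = ∑ e(r² τ + r z)`. -/
noncomputable def theta (τ z : ℂ) : ℂ := jacobiTheta₂ z (2 * τ)

lemma theta_add_int (τ z : ℂ) (n : ℤ) : theta (τ + n) z = theta τ z := by
  have h1 : ∀ τ, theta (τ + 1) z = theta τ z := fun τ => by
    rw [theta, mul_add, mul_one, jacobiTheta₂_add_right, theta]
  have : Function.Periodic (fun τ => theta τ z) 1 := h1
  simpa using this.int_mul n τ

lemma theta_neg (τ z : ℂ) : theta τ (-z) = theta τ z := jacobiTheta₂_neg_left _ _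

/-- Inversion conjugates the matrix `(1, 0; 4n, 1)` into a translation: `-1/(2τ/w) = -1/(2τ) - 2n`
for `w = 4nτ + 1`, and `jacobiTheta₂` has period `2`. The two square roots from the inversions are
taken in the right half plane, where they divide without a sign. -/
lemma theta_lower {τ : ℂ} (hτ : 0 < τ.im) (z : ℂ) (n : ℤ) :
    theta (τ / (4 * n * τ + 1)) (z / (4 * n * τ + 1)) =
      (4 * n * τ + 1) ^ (1 / 2 : ℂ) * e (n * z ^ 2 / (4 * n * τ + 1)) * theta τ z := by
  have hτ0 : τ ≠ 0 := by rintro rfl; simp at hτ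
  have hslit : 4 * n * τ + 1 ∈ Complex.slitPlane := by
    rw [Complex.mem_slitPlane_iff]
    rcases eq_or_ne n 0 with rfl | hn
    · simp
    · right
      have : (4 * n * τ + 1).im = 4 * n * τ.im := by simp [Complex.mul_im]
      rw [this]
      have : (n : ℝ) ≠ 0 := by exact_mod_cast hn
      positivity
  set w := 4 * n * τ + 1 with hw
  have hw0 : w ≠ 0 := Complex.slitPlane_ne_zero hslit
  have hdiv : 0 < (τ / w).im := by
    rw [Complex.div_im]
    have him : w.im = 4 * n * τ.im := by simp [hw, Complex.mul_im]
    have hre : w.re = 4 * n * τ.re + 1 := by simp [hw, Complex.mul_re]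
    have hns := Complex.normSq_pos.mpr hw0
    rw [him, hre, ← sub_div]
    apply div_pos _ hns
    nlinarith
  have hA : 0 < (-I * (2 * τ)).re := by simpa using hτ
  have hB : 0 < (-I * (2 * (τ / w))).re := by
    rw [Complex.mul_re, ← Complex.ofReal_ofNat, Complex.re_ofReal_mul, Complex.im_ofReal_mul]
    simpa using hdiv
  have hsq : w ^ (1 / 2 : ℂ) =
      (-I * (2 * τ)) ^ (1 / 2 : ℂ) / (-I * (2 * (τ / w))) ^ (1 / 2 : ℂ) := by
    rw [← cpow_half_div hA hB]
    congr 1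
    field_simp
  have f1 := jacobiTheta₂_functional_equation (z / w) (2 * (τ / w))
  have f2 := jacobiTheta₂_functional_equation z (2 * τ)
  have hz : z / w / (2 * (τ / w)) = z / (2 * τ) := by field_simp
  have hT : jacobiTheta₂ (z / (2 * τ)) (-1 / (2 * (τ / w))) =
      jacobiTheta₂ (z / (2 * τ)) (-1 / (2 * τ)) := by
    have h1 : ∀ t, jacobiTheta₂ (z / (2 * τ)) (t + 2) = jacobiTheta₂ (z / (2 * τ)) t := fun t =>
      jacobiTheta₂_add_right _ _
    have hper : Function.Periodic (fun t => jacobiTheta₂ (z / (2 * τ)) t) 2 := h1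
    have := hper.int_mul (-n) (-1 / (2 * τ))
    refine Eq.trans ?_ this
    congr 1
    rw [hw]; push_cast; field_simp; ring
  rw [hz, hT] at f1
  have hA0 : (-I * (2 * τ)) ^ (1 / 2 : ℂ) ≠ 0 := cpow_half_ne_zero (by simp [hτ0])
  rw [theta, theta, f1, f2]
  have hexp : cexp (-Real.pi * I * (z / w) ^ 2 / (2 * (τ / w))) =
      e (n * z ^ 2 / w) * cexp (-Real.pi * I * z ^ 2 / (2 * τ)) := by
    rw [e, ← Complex.exp_add]
    congr 1
    have : (1 : ℂ) = w - 4 * n * τ := by rw [hw]; ring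
    field_simp
    rw [hw]; ring
  rw [hexp, hsq]
  generalize (-I * (2 * τ)) ^ (1 / 2 : ℂ) = x at *
  field_simp

/-- The transformation law of `θ` under the matrix with entries `a`, `b`, `c`, `d`. -/
def ThetaLaw (a b c d : ℤ) : Prop :=
  ∀ τ : ℂ, 0 < τ.im → ∀ z : ℂ, theta ((a * τ + b) / (c * τ + d)) (z / (c * τ + d)) =
    thetaSign c d * (c * τ + d) ^ (1 / 2 : ℂ) * e (c * z ^ 2 / (4 * (c * τ + d))) * theta τ z

lemma mul_add_ne_zero {c d : ℤ} (h : IsCoprime c d) {τ : ℂ} (hτ : 0 < τ.im) :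
    (c * τ + d : ℂ) ≠ 0 := by
  intro h0
  have him : (c * τ + d : ℂ).im = c * τ.im := by simp [Complex.mul_im]
  rw [h0] at him
  have hc : c = 0 := by
    have : (c : ℝ) * τ.im = 0 := by simpa using him.symm
    rcases mul_eq_zero.mp this with h | h
    · exact_mod_cast h
    · exact absurd h hτ.ne'
  subst hc
  have hd : d = 0 := by simpa using h0
  subst hd
  exact absurd h (by decide)

/-- Right multiplication by `(1, n; 0, 1)`, one of the two moves of the descent; `θ` and the
multiplier are both invariant. -/
lemma ThetaLaw.add_mul {a b c d : ℤ} (h : ThetaLaw a b c d) (hc : (4 : ℤ) ∣ c) (h0 : c ≠ 0)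
    (hcd : IsCoprime c d) (n : ℤ) : ThetaLaw a (b + n * a) c (d + n * c) := by
  intro τ hτ z
  have := h (τ + n) (by simpa using hτ) z
  rw [theta_add_int] at this
  rw [thetaSign_add_mul hc h0 hcd]
  convert this using 2 <;> push_cast <;> ring_nf

/-- Right multiplication by `(1, 0; 4n, 1)`, the other move of the descent. Taking `d > 0` keeps the
principal square roots multiplicative: the imaginary parts of the two factors have the signs of `c`
and `n`, that of the product has the sign of `c + 4nd`. -/
lemma ThetaLaw.add_mul_left {a b c d : ℤ} (h : ThetaLaw a b c d) (hd : 0 < d)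
    (hcd : IsCoprime c d) (n : ℤ) : ThetaLaw (a + 4 * n * b) b (c + 4 * n * d) d := by
  intro τ hτ z
  have hcd' : IsCoprime (c + 4 * n * d) d := IsCoprime.add_mul_right_left hcd (4 * n)
  have h2 : (4 * n * τ + 1 : ℂ) ≠ 0 := by
    have := mul_add_ne_zero (c := 4 * n) (d := 1) isCoprime_one_right hτ
    push_cast at this; exact this
  have h3 := mul_add_ne_zero hcd' hτ
  have him2 : (4 * n * τ + 1 : ℂ).im = 4 * n * τ.im := by simp [Complex.mul_im]
  have hre2 : (4 * n * τ + 1 : ℂ).re = 4 * n * τ.re + 1 := by simp [Complex.mul_re]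
  have hτ' : 0 < (τ / (4 * n * τ + 1)).im := by
    rw [Complex.div_im, him2, hre2, ← sub_div]
    apply div_pos _ (Complex.normSq_pos.mpr h2)
    nlinarith
  have h1 := mul_add_ne_zero hcd hτ'
  have key := h _ hτ' (z / (4 * n * τ + 1))
  rw [theta_lower hτ] at key
  generalize hw : (4 * n * τ + 1 : ℂ) = w at *
  have hprod : ((c : ℂ) * (τ / w) + d) * w = ((c + 4 * n * d : ℤ) : ℂ) * τ + d := by
    push_cast; field_simp; linear_combination -d * hw
  have slit : ∀ (c : ℤ) (τ : ℂ), 0 < τ.im → (c * τ + d : ℂ) ∈ Complex.slitPlane := by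
    intro c τ hτ
    rw [Complex.mem_slitPlane_iff]
    rcases eq_or_ne c 0 with rfl | hc
    · left; simpa using hd
    · right
      have : (c * τ + d : ℂ).im = c * τ.im := by simp [Complex.mul_im]
      rw [this]
      have : (c : ℝ) ≠ 0 := by exact_mod_cast hc
      positivity
  have him : ∀ (c : ℤ) (τ : ℂ), (c * τ + d : ℂ).im = c * τ.im := by
    intro c τ; simp [Complex.mul_im]
  have hdR : (0 : ℝ) < d := by exact_mod_cast hd
  have hsqrt := cpow_half_mul (slit c _ hτ') (z₂ := w) (by
      rw [Complex.mem_slitPlane_iff, him2]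
      rcases eq_or_ne n 0 with rfl | hn
      · left; rw [hre2]; simp
      · right
        have : (n : ℝ) ≠ 0 := by exact_mod_cast hn
        positivity) (by rw [hprod]; exact slit _ _ hτ)
    (by
      rw [hprod, him, him, him2]
      intro ha hb
      have ha' := pos_of_mul_pos_left ha hτ'.le
      have hb' := pos_of_mul_pos_left hb hτ.le
      push_cast
      have := mul_pos hb' hdR
      exact mul_pos (by linarith) hτ)
    (by
      rw [hprod, him, him, him2]
      intro ha hb
      have ha' := neg_of_mul_neg_left ha hτ'.le
      have hb' := neg_of_mul_neg_left hb hτ.le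
      push_cast
      have := mul_neg_of_neg_of_pos hb' hdR
      exact mul_neg_of_neg_of_pos (by linarith) hτ)
  rw [hprod] at hsqrt
  have hq : ((a : ℂ) * (τ / w) + b) / (c * (τ / w) + d) =
      (((a + 4 * n * b : ℤ) : ℂ) * τ + b) / (((c + 4 * n * d : ℤ) : ℂ) * τ + d) := by
    have hnum : ((a : ℂ) * (τ / w) + b) * w = ((a + 4 * n * b : ℤ) : ℂ) * τ + b := by
      push_cast; field_simp; linear_combination -b * hw
    rw [← hnum, ← hprod, mul_div_mul_right _ _ h2]
  have hz : z / w / ((c : ℂ) * (τ / w) + d) =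
      z / (((c + 4 * n * d : ℤ) : ℂ) * τ + d) := by
    rw [← hprod, div_div, mul_comm]
  have hts : thetaSign (c + 4 * n * d) d = thetaSign c d := by
    rw [thetaSign, quadSymbol_add_mul_left hd, thetaSign]
  have he : e (c * (z / w) ^ 2 / (4 * (c * (τ / w) + d))) *
      e (n * z ^ 2 / w) =
      e (((c + 4 * n * d : ℤ) : ℂ) * z ^ 2 / (4 * (((c + 4 * n * d : ℤ) : ℂ) * τ + d))) := by
    rw [← e_add, ← hprod]
    congr 1
    generalize (c : ℂ) * (τ / w) + d = D at *
    push_cast at hprod ⊢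
    field_simp
    linear_combination z ^ 2 * (4 * n * hprod + (c + 4 * n * d) * hw)
  rw [hq, hz] at key
  rw [key, hts, hsqrt, ← he]
  ring

/-- Passing to `-γ` leaves `γτ` fixed and changes `z` to `-z`. The factor `±i` in the square root of
`-(cτ + d)` cancels the one in `thetaSign`. -/
lemma ThetaLaw.neg {a b c d : ℤ} (h : ThetaLaw a b c d) (hc : (4 : ℤ) ∣ c) (h0 : c ≠ 0)
    (hcd : IsCoprime c d) (hd : 0 < d) : ThetaLaw (-a) (-b) (-c) (-d) := by
  intro τ hτ z
  have key := h τ hτ z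
  have hneg : (((-c : ℤ) : ℂ) * τ + ((-d : ℤ) : ℂ)) = -(c * τ + d) := by push_cast; ring
  have hneg' : (((-a : ℤ) : ℂ) * τ + ((-b : ℤ) : ℂ)) = -(a * τ + b) := by push_cast; ring
  have him : (c * τ + d : ℂ).im = c * τ.im := by simp [Complex.mul_im]
  rw [hneg, hneg', neg_div_neg_eq, div_neg, theta_neg, key, thetaSign_neg_of_pos hc hcd hd]
  have he : e (((-c : ℤ) : ℂ) * z ^ 2 / (4 * -(c * τ + d))) =
      e (c * z ^ 2 / (4 * (c * τ + d))) := by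
    congr 1
    push_cast
    rw [mul_neg, neg_mul, neg_div_neg_eq]
  rw [he]
  rcases lt_or_gt_of_ne h0 with hc' | hc'
  · rw [cpow_half_neg_of_im_neg, if_neg hc'.not_gt]
    · linear_combination ((thetaSign c d * (c * τ + d) ^ (1 / 2 : ℂ) *
        e (c * z ^ 2 / (4 * (c * τ + d))) * theta τ z)) * I_sq
    · rw [him]
      exact mul_neg_of_neg_of_pos (by exact_mod_cast hc') hτ
  · rw [cpow_half_neg_of_im_pos, if_pos hc']
    · linear_combination ((thetaSign c d * (c * τ + d) ^ (1 / 2 : ℂ) *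
        e (c * z ^ 2 / (4 * (c * τ + d))) * theta τ z)) * I_sq
    · rw [him]
      exact mul_pos (by exact_mod_cast hc') hτ

lemma thetaSign_zero_one : thetaSign 0 1 = 1 := by simp [thetaSign, quadSymbol, epsD]

lemma thetaSign_zero_neg_one : thetaSign 0 (-1) = -I := by
  simp [thetaSign, quadSymbol, epsD]

lemma neg_one_cpow_half : (-1 : ℂ) ^ (1 / 2 : ℂ) = I := by
  rw [Complex.cpow_def_of_ne_zero (by simp), Complex.log_neg_one,
    show (Real.pi * I * (1 / 2) : ℂ) = Real.pi / 2 * I by ring, Complex.exp_pi_div_two_mul_I]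

lemma exists_two_mul_abs_sub_le (x : ℤ) {y : ℤ} (hy : y ≠ 0) : ∃ n : ℤ, 2 * |x - n * y| ≤ |y| := by
  have h1 := Int.emod_nonneg x hy
  have h2 := Int.emod_lt_abs x hy
  have h3 := Int.mul_ediv_add_emod x y
  by_cases h : 2 * (x % y) ≤ |y|
  · refine ⟨x / y, ?_⟩
    rw [show x - x / y * y = x % y by linarith [mul_comm y (x / y)], abs_of_nonneg h1]
    exact h
  · refine ⟨x / y + y.sign, ?_⟩
    have h4 : y.sign * y = |y| := by rw [Int.sign_mul_self_eq_abs]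
    rw [show x - (x / y + y.sign) * y = x % y - |y| by
      rw [add_mul, h4]; linarith [mul_comm y (x / y)], abs_of_neg (by linarith)]
    linarith

/-- The transformation law of the theta function on `Γ₀(4)`. -/
theorem thetaLaw {a b c d : ℤ} (hdet : a * d - b * c = 1) (hc : (4 : ℤ) ∣ c) :
    ThetaLaw a b c d := by
  induction hn : c.natAbs using Nat.strong_induction_on generalizing a b c d with
  | _ k ih =>
  rcases eq_or_ne c 0 with rfl | h0
  · rw [mul_zero, sub_zero] at hdet
    intro τ hτ z
    rcases Int.mul_eq_one_iff_eq_one_or_neg_one.mp hdet with ⟨rfl, rfl⟩ | ⟨rfl, rfl⟩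
    · rw [thetaSign_zero_one]
      simp [theta_add_int]
    · have := theta_add_int τ (-z) (-b)
      rw [theta_neg] at this
      rw [thetaSign_zero_neg_one]
      simp only [Int.cast_zero, zero_mul, zero_add, Int.cast_neg, Int.cast_one, zero_div, e_zero,
        neg_one_cpow_half, div_neg, div_one, theta_neg]
      rw [show -(-1 * τ + b : ℂ) = τ + ((-b : ℤ) : ℂ) by push_cast; ring, theta_add_int]
      simp
  -- reduction of the lower left entry, for a positive lower right entry
  have pos : ∀ {a b c d : ℤ}, a * d - b * c = 1 → (4 : ℤ) ∣ c → 0 < d → 2 * d < |c| →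
      c.natAbs = k → ThetaLaw a b c d := by
    intro a b c d hdet hc hd hlt hk
    obtain ⟨m, hm⟩ := exists_two_mul_abs_sub_le c (y := 4 * d) (by positivity)
    have hdet' : (a - 4 * m * b) * d - b * (c - 4 * m * d) = 1 := by linear_combination hdet
    have hm' : |c - 4 * m * d| < |c| := by
      rw [abs_of_pos (by positivity : 0 < 4 * d),
        show c - m * (4 * d) = c - 4 * m * d by ring] at hm
      linarith
    have hT := ih (c - 4 * m * d).natAbs (by rw [← hk]; rw [Int.abs_eq_natAbs, Int.abs_eq_natAbs] at hm'; omega) hdet'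
      (dvd_sub hc (by rw [mul_assoc]; exact dvd_mul_right _ _)) rfl
    have := hT.add_mul_left hd ⟨-b, a - 4 * m * b, by linear_combination hdet'⟩ m
    simpa using this
  -- Descent on `|c|`: reducing `d` modulo `c` gives `2|d| < |c|`, then reducing `c` modulo `4d`
  -- gives `|c| ≤ 2|d|` for the new `c`, a strict decrease.
  obtain ⟨n, hn'⟩ := exists_two_mul_abs_sub_le d h0
  have hdet' : a * (d - n * c) - (b - n * a) * c = 1 := by linear_combination hdet
  have hcop : IsCoprime c (d - n * c) := ⟨-(b - n * a), a, by linear_combination hdet'⟩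
  -- Equality would make `d - nc` a divisor of `c`, hence a unit, so `|c| = 2`, which `4 ∣ c`
  -- excludes.
  have hne : 2 * |d - n * c| ≠ |c| := by
    intro h
    have h2 : d - n * c ∣ c := by
      rw [← abs_dvd_abs, ← h]; exact dvd_mul_left _ _
    have hu : IsUnit (d - n * c) := hcop.isUnit_of_dvd' h2 dvd_rfl
    rw [Int.isUnit_iff_abs_eq.mp hu] at h
    rcases abs_choice c with h' | h' <;> rw [h'] at h <;> omega
  have hlt : 2 * |d - n * c| < |c| := lt_of_le_of_ne hn' hne
  have key : ThetaLaw a (b - n * a) c (d - n * c) := by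
    rcases lt_trichotomy (d - n * c) 0 with h | h | h
    · have := pos (a := -a) (b := -(b - n * a)) (c := -c) (d := -(d - n * c))
        (by linear_combination hdet') (by simpa using hc) (by linarith)
        (by rw [abs_neg]; rwa [abs_of_neg h] at hlt) (by rw [Int.natAbs_neg]; exact hn)
      have := this.neg (by simpa using hc) (by simpa using h0) hcop.neg_neg (by linarith)
      simpa only [neg_neg] using this
    · exfalso
      rw [h] at hcop
      have := Int.isUnit_iff.mp (isCoprime_zero_right.mp hcop)
      omega
    · exact pos hdet' hc h (by rwa [abs_of_pos h] at hlt) hn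
  have := key.add_mul hc h0 hcop n
  simpa using this

end EichlerZagier

namespace EichlerZagier

open Complex

/-! ### Theta decompositions as Fourier series -/

lemma hasSum_jacobiTheta (m : ℕ) [NeZero m] (μ : ZMod (2 * m)) (τ : ℍ) (z : ℂ) :
    HasSum (fun l : ℤ => e ((m : ℂ) * (((l : ℂ) + (μ.val : ℂ) / (2 * (m : ℂ))) ^ 2 * (τ : ℂ) +
      2 * ((l : ℂ) + (μ.val : ℂ) / (2 * (m : ℂ))) * z))) (jacobiTheta m μ τ z) := by
  have hm : (m : ℂ) ≠ 0 := NeZero.ne _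
  refine Summable.hasSum ?_
  have him : 0 < (2 * m * (τ : ℂ)).im := by
    have : (2 * m * (τ : ℂ)).im = 2 * m * τ.im := by simp [Complex.mul_im]
    rw [this]
    have : 0 < m := Nat.pos_of_ne_zero (NeZero.ne m)
    have := τ.im_pos
    positivity
  have h := (hasSum_jacobiTheta₂_term (μ.val * τ + 2 * m * z) him).summable.mul_left
    (e ((μ.val : ℂ) ^ 2 / (4 * m) * τ + μ.val * z))
  refine h.congr fun l => ?_
  rw [jacobiTheta₂_term, e, e, ← Complex.exp_add]
  congr 1
  field_simp
  ring

/-- Substituting `r = 2mℓ + μ` interleaves the `2m` theta series into one Fourier series in `z`.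
Identities between combinations of the `Θ_μ` become comparisons of Fourier coefficients. -/
lemma hasSum_thetaDecomposition (m : ℕ) [NeZero m] (x : ZMod (2 * m) → ℂ) (τ : ℍ) (z : ℂ) :
    HasSum (fun r : ℤ => x (r : ZMod (2 * m)) * e ((r : ℂ) ^ 2 / (4 * m) * τ) * e (r * z))
      (∑ μ : ZMod (2 * m), x μ * jacobiTheta m μ τ z) := by
  have hm : (m : ℂ) ≠ 0 := NeZero.ne _
  have hm' : m ≠ 0 := NeZero.ne _
  let f : ℤ → ℂ := fun r => x (r : ZMod (2 * m)) * e ((r : ℂ) ^ 2 / (4 * m) * τ) * e (r * z)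
  have hμ : ∀ μ : ZMod (2 * m),
      HasSum (fun r : ℤ => if (r : ZMod (2 * m)) = μ then f r else 0)
        (x μ * jacobiTheta m μ τ z) := by
    intro μ
    let i : ℤ → ℤ := fun l => 2 * m * l + μ.val
    have hi : Function.Injective i := by
      intro a b hab
      have h2 : (2 * m : ℤ) ≠ 0 := by positivity
      simpa [i, h2, hm'] using hab
    have hcast : ∀ l, ((i l : ℤ) : ZMod (2 * m)) = μ := by
      intro l
      have h0 : (2 * m : ZMod (2 * m)) = 0 := by
        exact_mod_cast ZMod.natCast_self (2 * m)
      simp only [i]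
      push_cast
      rw [h0, zero_mul, zero_add, ZMod.natCast_zmod_val]
    rw [← hi.hasSum_iff]
    · refine ((hasSum_jacobiTheta m μ τ z).mul_left (x μ)).congr_fun ?_
      intro l
      simp only [Function.comp, hcast, if_true, f]
      rw [mul_assoc, ← e_add]
      congr 2
      simp only [i]
      push_cast
      field_simp
      ring
    · intro r hr
      rw [if_neg]
      rintro rfl
      apply hr
      refine ⟨r / (2 * m), ?_⟩
      simp only [i]
      rw [ZMod.val_intCast]
      push_cast
      exact Int.mul_ediv_add_emod r (2 * m)
  have := hasSum_sum (s := Finset.univ) fun μ _ => hμ μ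
  refine this.congr_fun ?_
  intro r
  simp [f]

/-- Uniqueness of the coefficients of an absolutely convergent Fourier series. -/
lemma fourier_unique {a b : ℤ → ℂ} {F : ℝ → ℂ} (ha : ∀ x : ℝ, HasSum (fun r => a r * e (r * x)) (F x))
    (hb : ∀ x : ℝ, HasSum (fun r => b r * e (r * x)) (F x)) : a = b := by
  have hc : ∀ x : ℝ, HasSum (fun r => (a r - b r) * e (r * x)) 0 := fun x => by
    simpa [sub_mul] using (ha x).sub (hb x)
  have hs : Summable fun r => ‖a r - b r‖ := by
    have := (hc 0).summable.norm
    simpa using this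
  have hcont : ∀ n : ℤ, Continuous fun x : ℝ => e (n * x) := fun n => by
    unfold e; fun_prop
  have hint : ∀ n : ℤ, n ≠ 0 → ∫ x in (0 : ℝ)..1, e (n * x) = 0 := by
    intro n hn
    have hn' : (2 * Real.pi * I * n : ℂ) ≠ 0 := by
      simp [Real.pi_ne_zero, hn]
    have : ∀ x : ℝ, e (n * x) = cexp ((2 * Real.pi * I * n) * x) := fun x => by
      rw [e, mul_assoc (2 * Real.pi * I)]
    simp_rw [this]
    rw [integral_exp_mul_complex hn']
    have := e_int n
    rw [e] at this
    simp [this]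
  funext s
  rw [← sub_eq_zero]
  -- The difference series multiplied by `e(-sx)`; integrating it termwise over a period isolates
  -- the coefficient at `s`.
  let f : ℤ → C(ℝ, ℂ) := fun r => ⟨fun x => (a r - b r) * e (((r - s : ℤ) : ℂ) * x),
    continuous_const.mul (hcont _)⟩
  have hnorm : ∀ (n : ℤ) (x : ℝ), ‖e (n * x)‖ = 1 := fun n x => by
    rw [norm_e]; simp
  have h := intervalIntegral.hasSum_intervalIntegral_of_summable_norm (f := f) (a := 0) (b := 1) (by
    refine Summable.of_nonneg_of_le (fun _ => norm_nonneg _) (fun r => ?_) hs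
    rw [ContinuousMap.norm_le _ (norm_nonneg _)]
    intro x
    simp [f, hnorm, -Int.cast_sub])
  have hz : ∀ x : ℝ, ∑' r, f r x = 0 := by
    intro x
    have := (hc x).mul_right (e (-(s * x)))
    rw [zero_mul] at this
    rw [← this.tsum_eq]
    refine tsum_congr fun r => ?_
    simp only [f, ContinuousMap.coe_mk]
    rw [mul_assoc, ← e_add]
    congr 2
    push_cast; ring
  simp only [hz, intervalIntegral.integral_zero] at h
  have h2 := hasSum_single (f := fun r => ∫ x in (0 : ℝ)..1, f r x) s (by
    intro r hr
    simp only [f, ContinuousMap.coe_mk, intervalIntegral.integral_const_mul]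
    rw [hint _ (sub_ne_zero.mpr hr), mul_zero])
  have h3 := h2.unique h
  simpa [f] using h3

/-- Linear independence of the `Θ_μ(τ, ·)` at a fixed `τ`; this is how laws for `φ` or for theta
series are turned into laws for their coefficients. -/
lemma jacobiTheta_coeff_unique {m : ℕ} [NeZero m] {x y : ZMod (2 * m) → ℂ} {τ : ℍ}
    (h : ∀ z, ∑ μ, x μ * jacobiTheta m μ τ z = ∑ μ, y μ * jacobiTheta m μ τ z) : x = y := by
  have := fourier_unique (F := fun z : ℝ => ∑ μ, x μ * jacobiTheta m μ τ z)
    (fun z => hasSum_thetaDecomposition m x τ z)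
    (fun z => by rw [h]; exact hasSum_thetaDecomposition m y τ z)
  funext μ
  have h1 := congrFun this (μ.val : ℤ)
  have h2 := mul_right_cancel₀ (e_ne_zero _) h1
  simpa using h2

lemma IsThetaDecomposition.unique {m : ℕ} [NeZero m] {φ : ℍ → ℂ → ℂ} {g h : ZMod (2 * m) → ℍ → ℂ}
    (hg : IsThetaDecomposition m φ g) (hh : IsThetaDecomposition m φ h) : g = h := by
  funext μ τ
  exact congrFun (jacobiTheta_coeff_unique (x := fun μ => g μ τ) (y := fun μ => h μ τ)
    fun z => (hg τ z).symm.trans (hh τ z)) μ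

lemma HasJacobiExpansion.summable {N : ℕ} {F : ℍ → ℂ → ℂ} {c : ℕ → ℤ → ℂ}
    (hF : HasJacobiExpansion N F c) (r : ℤ) (τ : ℍ) :
    Summable fun n : ℕ => c n r * e ((n : ℂ) / N * τ) := by
  have := (hF τ 0).summable.prod_symm.prod_factor r
  simpa using this

lemma HasJacobiExpansion.hasSum {N : ℕ} {F : ℍ → ℂ → ℂ} {c : ℕ → ℤ → ℂ}
    (hF : HasJacobiExpansion N F c) (τ : ℍ) (z : ℂ) :
    HasSum (fun r : ℤ => (∑' n : ℕ, c n r * e ((n : ℂ) / N * τ)) * e (r * z)) (F τ z) := by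
  have h1 := ((Equiv.prodComm ℤ ℕ).hasSum_iff (f := fun x : ℕ × ℤ =>
    c x.1 x.2 * e ((x.1 : ℂ) / (N : ℂ) * (τ : ℂ)) * e ((x.2 : ℂ) * z))).mpr (hF τ z)
  refine h1.prod_fiberwise fun r => ?_
  exact (hF.summable r τ).hasSum.mul_right _

/-- The theta components of a function with a Fourier expansion are given by `q`-series. -/
lemma IsThetaDecomposition.hasSum_component {m N : ℕ} [NeZero m] {F : ℍ → ℂ → ℂ}
    {c : ℕ → ℤ → ℂ} {h : ZMod (2 * m) → ℍ → ℂ} (hF : HasJacobiExpansion N F c)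
    (hh : IsThetaDecomposition m F h) (r : ℤ) (τ : ℍ) :
    HasSum (fun n : ℕ => c n r * e (((n : ℂ) / N - (r : ℂ) ^ 2 / (4 * m)) * τ))
      (h (r : ZMod (2 * m)) τ) := by
  have h1 := fourier_unique (F := fun z : ℝ => F τ z) (fun z => hF.hasSum τ z) (fun z => by
    have := hasSum_thetaDecomposition m (fun μ => h μ τ) τ z
    rwa [← hh τ z] at this)
  have h2 := congrFun h1 r
  have h3 := (hF.summable r τ).hasSum
  rw [h2] at h3
  have h4 := h3.mul_right (e (-((r : ℂ) ^ 2 / (4 * m) * τ)))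
  rw [mul_assoc, ← e_add, add_neg_cancel, e_zero, mul_one] at h4
  refine h4.congr_fun fun n => ?_
  rw [mul_assoc, ← e_add]
  congr 2
  ring

/-- Expanding `F(τ, z + τ)` in two ways gives `a(r + 2m) = a(r) e((r + m)τ)`. Completing the square,
`a(r) e(-r²τ/4m)` has period `2m`, and its values are the components. -/
lemma exists_thetaDecomposition {m N : ℕ} [NeZero m] {F : ℍ → ℂ → ℂ} {c : ℕ → ℤ → ℂ}
    (hF : HasJacobiExpansion N F c)
    (hell : ∀ (τ : ℍ) (z : ℂ), F τ (z + τ) = e (-(m : ℂ) * (τ + 2 * z)) * F τ z) :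
    ∃ h, IsThetaDecomposition m F h := by
  have hm : (m : ℂ) ≠ 0 := NeZero.ne _
  let a : ℍ → ℤ → ℂ := fun τ r => ∑' n : ℕ, c n r * e ((n : ℂ) / N * τ)
  have ha : ∀ τ z, HasSum (fun r => a τ r * e (r * z)) (F τ z) := hF.hasSum
  have hrec : ∀ τ r, a τ (r + 2 * m) = a τ r * e ((r + m) * τ) := by
    intro τ
    have h1 := fourier_unique (a := fun r => a τ r * e ((r + m) * τ))
      (b := fun r => a τ (r + 2 * m)) (F := fun x => F τ x * e (-(2 * m * x)))
      (fun x => by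
        have := (ha τ (x + τ)).mul_right (e (m * τ))
        rw [hell, mul_right_comm, ← e_add, mul_comm (e _),
          show -(m : ℂ) * (τ + 2 * x) + m * τ = -(2 * m * x) by ring] at this
        refine this.congr_fun fun r => ?_
        rw [mul_assoc, mul_assoc, ← e_add, ← e_add]
        congr 2; ring)
      (fun x => by
        have := ((ha τ x).mul_right (e (-(2 * m * x))))
        rw [← (Equiv.addRight (2 * m : ℤ)).hasSum_iff] at this
        refine this.congr_fun fun r => ?_
        simp only [Function.comp_apply, Equiv.coe_addRight]
        rw [mul_assoc, ← e_add]
        congr 2; push_cast; ring)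
    intro r
    exact (congrFun h1 r).symm
  let b : ℍ → ℤ → ℂ := fun τ r => a τ r * e (-((r : ℂ) ^ 2 / (4 * m) * τ))
  have hb : ∀ τ, Function.Periodic (b τ) (2 * m : ℤ) := by
    intro τ r
    simp only [b]
    rw [hrec, mul_assoc, ← e_add]
    congr 2
    push_cast
    field_simp
    ring
  refine ⟨fun μ τ => b τ (μ.val : ℤ), fun τ z => ?_⟩
  refine (ha τ z).unique ((hasSum_thetaDecomposition m _ τ z).congr_fun fun r => ?_)
  have : b τ (((r : ZMod (2 * m)).val : ℕ) : ℤ) = b τ r := by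
    rw [ZMod.val_intCast]
    push_cast
    rw [Int.emod_def, mul_comm]
    exact (hb τ).sub_int_mul_eq _
  simp only [this]
  simp only [b]
  rw [mul_assoc (a τ r), ← e_add]
  simp

end EichlerZagier

namespace EichlerZagier

open Complex

/-! ### The slash operator -/

/-- The denominator `c τ + d`. -/
def den (γ : SL(2, ℤ)) (τ : ℍ) : ℂ := (γ 1 0 : ℂ) * (τ : ℂ) + (γ 1 1 : ℂ)

lemma det_eq_one (γ : SL(2, ℤ)) : γ 0 0 * γ 1 1 - γ 0 1 * γ 1 0 = 1 := by
  rw [← Matrix.det_fin_two, γ.det_coe]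

lemma isCoprime_bottom (γ : SL(2, ℤ)) : IsCoprime (γ 1 0) (γ 1 1) :=
  ⟨-γ 0 1, γ 0 0, by linear_combination det_eq_one γ⟩

lemma den_ne_zero (γ : SL(2, ℤ)) (τ : ℍ) : den γ τ ≠ 0 :=
  mul_add_ne_zero (isCoprime_bottom γ) τ.im_pos

lemma coe_smul_eq (γ : SL(2, ℤ)) (τ : ℍ) :
    ((γ • τ : ℍ) : ℂ) = ((γ 0 0 : ℂ) * τ + γ 0 1) / den γ τ := by
  rw [UpperHalfPlane.coe_specialLinearGroup_apply]
  simp [den]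

lemma mul_apply_eq (γ₁ γ₂ : SL(2, ℤ)) (i j : Fin 2) :
    (γ₁ * γ₂) i j = γ₁ i 0 * γ₂ 0 j + γ₁ i 1 * γ₂ 1 j := by
  rw [Matrix.SpecialLinearGroup.coe_mul, Matrix.mul_apply, Fin.sum_univ_two]

lemma den_mul (γ₁ γ₂ : SL(2, ℤ)) (τ : ℍ) : den (γ₁ * γ₂) τ = den γ₁ (γ₂ • τ) * den γ₂ τ := by
  have h := den_ne_zero γ₂ τ
  rw [den, den, coe_smul_eq, mul_apply_eq, mul_apply_eq]
  field_simp
  rw [den]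
  push_cast
  ring

lemma jacobiSlash_eq (k : ℤ) (m : ℕ) (φ : ℍ → ℂ → ℂ) (γ : SL(2, ℤ)) (τ : ℍ) (z : ℂ) :
    jacobiSlash k m φ γ τ z = φ (γ • τ) (z / den γ τ) * den γ τ ^ (-k) *
      e (-(m : ℂ) * γ 1 0 * z ^ 2 / den γ τ) := rfl

lemma jacobiSlash_one (k : ℤ) (m : ℕ) (φ : ℍ → ℂ → ℂ) : jacobiSlash k m φ 1 = φ := by
  funext τ z
  simp [jacobiSlash_eq, den]

lemma jacobiSlash_mul (k : ℤ) (m : ℕ) (φ : ℍ → ℂ → ℂ) (γ₁ γ₂ : SL(2, ℤ)) :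
    jacobiSlash k m φ (γ₁ * γ₂) = jacobiSlash k m (jacobiSlash k m φ γ₁) γ₂ := by
  funext τ z
  have h₂ := den_ne_zero γ₂ τ
  have h₁ := den_ne_zero γ₁ (γ₂ • τ)
  rw [jacobiSlash_eq, jacobiSlash_eq k m (jacobiSlash k m φ γ₁), jacobiSlash_eq, den_mul, mul_smul,
    mul_zpow, div_mul_eq_div_div_swap]
  have hden : den γ₁ (γ₂ • τ) * den γ₂ τ =
      γ₁ 1 0 * (γ₂ 0 0 * τ + γ₂ 0 1) + γ₁ 1 1 * den γ₂ τ := by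
    rw [den, coe_smul_eq]; field_simp
  have hdet : (γ₂ 0 0 : ℂ) * γ₂ 1 1 - γ₂ 0 1 * γ₂ 1 0 = 1 := by exact_mod_cast det_eq_one γ₂
  have he : e (-(m : ℂ) * (γ₁ * γ₂) 1 0 * z ^ 2 / (den γ₁ (γ₂ • τ) * den γ₂ τ)) =
      e (-(m : ℂ) * γ₁ 1 0 * (z / den γ₂ τ) ^ 2 / den γ₁ (γ₂ • τ)) *
        e (-(m : ℂ) * γ₂ 1 0 * z ^ 2 / den γ₂ τ) := by
    rw [← e_add]
    congr 1
    rw [mul_apply_eq]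
    push_cast
    have hd : den γ₂ τ = γ₂ 1 0 * τ + γ₂ 1 1 := rfl
    generalize den γ₁ (γ₂ • τ) = x at *
    generalize den γ₂ τ = y at *
    field_simp
    linear_combination m * z ^ 2 * ((γ₂ 1 0 : ℂ) * hden - (γ₁ 1 0 : ℂ) * γ₂ 0 0 * hd -
      (γ₁ 1 0 : ℂ) * hdet)
  rw [he]
  ring

/-! ### The Weil representation on theta functions -/

/-- `γ` acts on the theta functions of index `m` by a unitary matrix, up to a square root of
`c τ + d`. -/
def ActsUnitarily (m : ℕ) [NeZero m] (γ : SL(2, ℤ)) : Prop :=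
  ∃ M ∈ Matrix.unitaryGroup (ZMod (2 * m)) ℂ, ∀ τ : ℍ, ∃ s : ℂ, s ^ 2 = den γ τ ∧
    ∀ μ z, jacobiSlash 0 m (jacobiTheta m μ) γ τ z = s * ∑ ν, M μ ν * jacobiTheta m ν τ z

lemma jacobiTheta_eq (m : ℕ) [NeZero m] (μ : ZMod (2 * m)) (τ : ℍ) (z : ℂ) :
    jacobiTheta m μ τ z = e ((μ.val : ℂ) ^ 2 / (4 * m) * τ + μ.val * z) *
      jacobiTheta₂ (μ.val * τ + 2 * m * z) (2 * m * τ) := by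
  have hm : (m : ℂ) ≠ 0 := NeZero.ne _
  rw [jacobiTheta, jacobiTheta₂, ← tsum_mul_left]
  refine tsum_congr fun l => ?_
  rw [jacobiTheta₂_term, e, e, ← Complex.exp_add]
  congr 1
  field_simp
  ring

lemma jacobiTheta_add_int (m : ℕ) [NeZero m] (μ : ZMod (2 * m)) {τ τ' : ℍ} (n : ℤ)
    (h : (τ' : ℂ) = τ + n) (z : ℂ) :
    jacobiTheta m μ τ' z = e (n * (μ.val : ℂ) ^ 2 / (4 * m)) * jacobiTheta m μ τ z := by
  have hm : (m : ℂ) ≠ 0 := NeZero.ne _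
  rw [jacobiTheta, jacobiTheta, ← tsum_mul_left]
  refine tsum_congr fun l => ?_
  rw [← e_add, h]
  refine e_eq_of_sub (n * (m * l ^ 2 + l * μ.val)) ?_
  push_cast
  field_simp
  ring

lemma stdAddChar_eq (m : ℕ) [NeZero m] (r : ℤ) :
    ZMod.stdAddChar (r : ZMod m) = e (r / m) := by
  rw [ZMod.stdAddChar_coe, e]
  congr 1
  ring

/-- The phase `e(-μr/2m)` is a shift of `z` in the interleaved series, so the finite Fourier
transform of the `Θ_ν` is a single `jacobiTheta₂`: the shape produced by inversion. -/
lemma sum_stdAddChar_mul_jacobiTheta (m : ℕ) [NeZero m] (μ : ZMod (2 * m)) (τ : ℍ) (z : ℂ) :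
    ∑ ν, ZMod.stdAddChar (-(μ * ν)) * jacobiTheta m ν τ z =
      jacobiTheta₂ (μ.val / (2 * m) - z) (τ / (2 * m)) := by
  have hm : (m : ℂ) ≠ 0 := NeZero.ne _
  refine (hasSum_thetaDecomposition m _ τ z).unique ?_
  have him : 0 < ((τ : ℂ) / (2 * m)).im := by
    have : ((τ : ℂ) / (2 * m)).im = τ.im / (2 * m) := by
      rw [show (2 * m : ℂ) = ((2 * m : ℝ) : ℂ) by push_cast; rfl, Complex.div_ofReal_im]; rfl
    rw [this]
    have : 0 < m := Nat.pos_of_ne_zero (NeZero.ne m)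
    have := τ.im_pos
    positivity
  have := hasSum_jacobiTheta₂_term (z - μ.val / (2 * m)) him
  rw [← neg_sub, jacobiTheta₂_neg_left]
  refine this.congr_fun fun r => ?_
  have h1 : (-(μ * (r : ZMod (2 * m)))) = ((-(μ.val * r) : ℤ) : ZMod (2 * m)) := by
    push_cast
    rw [ZMod.natCast_zmod_val]
  simp only [h1]
  rw [stdAddChar_eq, ← e_add, ← e_add, jacobiTheta₂_term, e]
  congr 1
  push_cast
  field_simp
  ring

lemma actsUnitarily_one (m : ℕ) [NeZero m] : ActsUnitarily m 1 := by
  refine ⟨1, one_mem _, fun τ => ⟨1, by simp [den], fun μ z => ?_⟩⟩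
  rw [jacobiSlash_one]
  simp [Matrix.one_apply]

/-- The root `s` of `cτ + d` may have any sign at each `τ`, so roots simply multiply and no
metaplectic cocycle has to be tracked. -/
lemma ActsUnitarily.mul {m : ℕ} [NeZero m] {γ₁ γ₂ : SL(2, ℤ)} (h₁ : ActsUnitarily m γ₁)
    (h₂ : ActsUnitarily m γ₂) : ActsUnitarily m (γ₁ * γ₂) := by
  obtain ⟨M₁, hM₁, h₁⟩ := h₁
  obtain ⟨M₂, hM₂, h₂⟩ := h₂
  refine ⟨M₁ * M₂, mul_mem hM₁ hM₂, fun τ => ?_⟩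
  obtain ⟨s₂, hs₂, h₂⟩ := h₂ τ
  obtain ⟨s₁, hs₁, h₁⟩ := h₁ (γ₂ • τ)
  refine ⟨s₁ * s₂, by rw [mul_pow, hs₁, hs₂, den_mul], fun μ z => ?_⟩
  rw [jacobiSlash_mul, jacobiSlash_eq, h₁]
  have h3 : ∀ ν, jacobiTheta m ν (γ₂ • τ) (z / den γ₂ τ) *
      e (-(m : ℂ) * γ₂ 1 0 * z ^ 2 / den γ₂ τ) = s₂ * ∑ ν', M₂ ν ν' * jacobiTheta m ν' τ z := by
    intro ν
    rw [← h₂, jacobiSlash_eq, neg_zero, zpow_zero, mul_one]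
  rw [neg_zero, zpow_zero, mul_one, mul_assoc, Finset.sum_mul]
  simp_rw [mul_assoc (M₁ _ _), h3, Matrix.mul_apply, Finset.mul_sum, Finset.sum_mul, Finset.mul_sum]
  rw [Finset.sum_comm]
  refine Finset.sum_congr rfl fun ν _ => Finset.sum_congr rfl fun ν' _ => ?_
  ring

lemma ActsUnitarily.inv {m : ℕ} [NeZero m] {γ : SL(2, ℤ)} (h : ActsUnitarily m γ) :
    ActsUnitarily m γ⁻¹ := by
  obtain ⟨M, hM, h⟩ := h
  have hM' : star M * M = 1 := Matrix.mem_unitaryGroup_iff'.mp hM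
  refine ⟨star M, Unitary.star_mem hM, fun τ => ?_⟩
  obtain ⟨s, hs, h⟩ := h (γ⁻¹ • τ)
  have hs0 : s ≠ 0 := by
    rintro rfl
    exact den_ne_zero γ (γ⁻¹ • τ) (by rw [← hs]; simp)
  refine ⟨s⁻¹, ?_, fun μ z => ?_⟩
  · have := den_mul γ γ⁻¹ τ
    rw [mul_inv_cancel, ← hs] at this
    have h1 : den 1 τ = 1 := by simp [den]
    rw [h1] at this
    rw [inv_pow]
    exact inv_eq_of_mul_eq_one_right this.symm
  have h1 : ∀ ν, jacobiTheta m ν τ z =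
      s * ∑ ν', M ν ν' * jacobiSlash 0 m (jacobiTheta m ν') γ⁻¹ τ z := by
    intro ν
    have := jacobiSlash_mul 0 m (jacobiTheta m ν) γ γ⁻¹
    rw [mul_inv_cancel, jacobiSlash_one] at this
    rw [this, jacobiSlash_eq, h, neg_zero, zpow_zero, mul_one, mul_assoc, Finset.sum_mul]
    congr 1
    refine Finset.sum_congr rfl fun ν' _ => ?_
    rw [jacobiSlash_eq, neg_zero, zpow_zero, mul_one, mul_assoc]
  simp_rw [h1, Finset.mul_sum]
  rw [Finset.sum_comm]
  have h2 : ∀ ν', ∑ ν, s⁻¹ * (star M μ ν * (s * (M ν ν' *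
      jacobiSlash 0 m (jacobiTheta m ν') γ⁻¹ τ z))) =
      (star M * M) μ ν' * jacobiSlash 0 m (jacobiTheta m ν') γ⁻¹ τ z := by
    intro ν'
    rw [Matrix.mul_apply, Finset.sum_mul]
    refine Finset.sum_congr rfl fun ν _ => ?_
    field_simp
  simp_rw [h2, hM', Matrix.one_apply]
  simp

lemma actsUnitarily_T (m : ℕ) [NeZero m] : ActsUnitarily m ModularGroup.T := by
  refine ⟨Matrix.diagonal fun μ => e ((μ.val : ℂ) ^ 2 / (4 * m)), ?_, fun τ => ⟨1, ?_, ?_⟩⟩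
  · rw [Matrix.mem_unitaryGroup_iff, Matrix.star_eq_conjTranspose, Matrix.diagonal_conjTranspose,
      Matrix.diagonal_mul_diagonal, ← Matrix.diagonal_one]
    congr 1
    funext μ
    rw [Pi.star_apply, RCLike.star_def, Complex.mul_conj, Complex.normSq_eq_norm_sq, norm_e]
    have : ((μ.val : ℂ) ^ 2 / (4 * m)).im = 0 := by
      have : ((μ.val : ℂ) ^ 2 / (4 * m)) = (((μ.val : ℝ) ^ 2 / (4 * m) : ℝ) : ℂ) := by push_cast; rfl
      rw [this, Complex.ofReal_im]
    rw [this]; simp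
  · simp [den, ModularGroup.T]
  · intro μ z
    have hd : den ModularGroup.T τ = 1 := by simp [den, ModularGroup.T]
    have h1 : ((ModularGroup.T • τ : ℍ) : ℂ) = τ + (1 : ℤ) := by
      rw [coe_smul_eq, hd]; simp [ModularGroup.T]
    rw [jacobiSlash_eq, hd, jacobiTheta_add_int m μ 1 h1]
    simp [Matrix.diagonal_apply, ModularGroup.T]

/-- The inversion formula for the theta functions of index `m`. -/
lemma exists_jacobiSlash_S_jacobiTheta (m : ℕ) [NeZero m] (τ : ℍ) :
    ∃ u : ℂ, u ≠ 0 ∧ u ^ 2 * τ = 2 * m * I ∧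
      ∀ μ z, jacobiSlash 0 m (jacobiTheta m μ) ModularGroup.S τ z =
        u⁻¹ * ∑ ν, ZMod.stdAddChar (-(μ * ν)) * jacobiTheta m ν τ z := by
  have hm : (m : ℂ) ≠ 0 := NeZero.ne _
  have hτ : (τ : ℂ) ≠ 0 := τ.ne_zero
  have hd : den ModularGroup.S τ = τ := by simp [den, ModularGroup.S]
  have h1 : ((ModularGroup.S • τ : ℍ) : ℂ) = -1 / τ := by
    rw [coe_smul_eq, hd]; simp [ModularGroup.S]
  set u : ℂ := (-I * (2 * m * (-1 / τ))) ^ (1 / 2 : ℂ) with hu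
  have hu2 : u ^ 2 = -I * (2 * m * (-1 / τ)) := cpow_half_sq _
  have hu0 : u ≠ 0 := cpow_half_ne_zero (by simp [hm, hτ])
  refine ⟨u, hu0, ?_, fun μ z => ?_⟩
  · rw [hu2]; field_simp
  · rw [sum_stdAddChar_mul_jacobiTheta, jacobiSlash_eq, hd, jacobiTheta_eq, h1, jacobiTheta₂_functional_equation, ← hu]
    have a1 : ((μ.val : ℂ) * (-1 / τ) + 2 * m * (z / τ)) / (2 * m * (-1 / τ)) =
        (μ.val / (2 * m) - z : ℂ) := by
      field_simp; ring
    have a2 : (-1 : ℂ) / (2 * m * (-1 / τ)) = (τ / (2 * m) : ℂ) := by field_simp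
    rw [a1, a2, neg_zero, zpow_zero, mul_one]
    have hexp : e ((μ.val : ℂ) ^ 2 / (4 * m) * (-1 / τ) + μ.val * (z / τ)) *
        cexp (-Real.pi * I * (μ.val * (-1 / τ) + 2 * m * (z / τ)) ^ 2 / (2 * m * (-1 / τ))) *
        e (-(m : ℂ) * ModularGroup.S 1 0 * z ^ 2 / τ) = 1 := by
      rw [e, e, ← Complex.exp_add, ← Complex.exp_add, Complex.exp_eq_one_iff]
      refine ⟨0, ?_⟩
      simp only [ModularGroup.S, Matrix.of_apply, Matrix.cons_val', Matrix.cons_val_zero,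
        Matrix.cons_val_one, Int.cast_one, Int.cast_zero]
      field_simp
      ring
    generalize jacobiTheta₂ (μ.val / (2 * m) - z : ℂ) (τ / (2 * m)) = J at *
    generalize cexp (-Real.pi * I * (μ.val * (-1 / τ) + 2 * m * (z / τ)) ^ 2 /
      (2 * m * (-1 / τ))) = E₁ at *
    calc _ = (e ((μ.val : ℂ) ^ 2 / (4 * m) * (-1 / τ) + μ.val * (z / τ)) * E₁ *
          e (-(m : ℂ) * ModularGroup.S 1 0 * z ^ 2 / τ)) * (1 / u * J) := by ring
      _ = _ := by rw [hexp]; field_simp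

lemma actsUnitarily_S (m : ℕ) [NeZero m] : ActsUnitarily m ModularGroup.S := by
  have hm : (m : ℂ) ≠ 0 := NeZero.ne _
  -- A normalisation independent of `τ`: `|w|² = 2m` makes the Fourier matrix unitary, and `u²τ =
  -- 2mi` gives `(w/u)² = τ`.
  set w : ℂ := (2 * m * I) ^ (1 / 2 : ℂ) with hw
  have hw2 : w ^ 2 = 2 * m * I := cpow_half_sq _
  have hw0 : w ≠ 0 := by rintro h; rw [h] at hw2; simp [hm] at hw2
  have hwn : w * star w = 2 * m := by
    rw [RCLike.star_def, Complex.mul_conj, Complex.normSq_eq_norm_sq, ← norm_pow, hw2]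
    simp
  refine ⟨w⁻¹ • Matrix.of fun μ ν => ZMod.stdAddChar (-(μ * ν)), ?_, fun τ => ?_⟩
  · rw [Matrix.mem_unitaryGroup_iff]
    ext μ ν
    rw [Matrix.mul_apply]
    have h1 : ∀ l, (w⁻¹ • Matrix.of fun μ ν : ZMod (2 * m) => ZMod.stdAddChar (-(μ * ν))) μ l *
        star (w⁻¹ • Matrix.of fun μ ν : ZMod (2 * m) => ZMod.stdAddChar (-(μ * ν))) l ν =
        (2 * m : ℂ)⁻¹ * ZMod.stdAddChar (l * (ν - μ)) := by
      intro l
      rw [Matrix.star_apply, Matrix.smul_apply, Matrix.smul_apply, star_smul, ← hwn]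
      simp only [Matrix.of_apply, smul_eq_mul, star_inv₀, mul_inv, RCLike.star_def]
      rw [← AddChar.map_neg_eq_conj, neg_neg, show l * (ν - μ) = -(μ * l) + ν * l by ring,
        AddChar.map_add_eq_mul]
      ring
    simp_rw [h1]
    rw [← Finset.mul_sum, AddChar.sum_mulShift _ (ZMod.isPrimitive_stdAddChar _), ZMod.card,
      Matrix.one_apply]
    simp only [sub_eq_zero, eq_comm (a := ν)]
    split_ifs
    · push_cast
      field_simp
    · simp
  obtain ⟨u, hu0, hu2, hu⟩ := exists_jacobiSlash_S_jacobiTheta m τ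
  have hd : den ModularGroup.S τ = τ := by simp [den, ModularGroup.S]
  refine ⟨w / u, ?_, fun μ z => ?_⟩
  · rw [div_pow, hw2, ← hu2, hd]; field_simp
  · rw [hu, Finset.mul_sum, Finset.mul_sum]
    refine Finset.sum_congr rfl fun ν _ => ?_
    simp only [Matrix.smul_apply, Matrix.of_apply, smul_eq_mul]
    field_simp

theorem actsUnitarily (m : ℕ) [NeZero m] (γ : SL(2, ℤ)) : ActsUnitarily m γ := by
  have h : γ ∈ Subgroup.closure {ModularGroup.S, ModularGroup.T} := by
    simp [SpecialLinearGroup.SL2Z_generators]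
  induction h using Subgroup.closure_induction with
  | mem x hx =>
    rcases hx with rfl | rfl
    · exact actsUnitarily_S m
    · exact actsUnitarily_T m
  | one => exact actsUnitarily_one m
  | mul x y _ _ hx hy => exact hx.mul hy
  | inv x _ hx => exact hx.inv

end EichlerZagier

namespace EichlerZagier

open Complex

/-! ### Twisted theta functions -/

lemma theta_add_right_int (τ z : ℂ) (n : ℤ) : theta τ (z + n) = theta τ z := by
  have : Function.Periodic (fun z => theta τ z) 1 := fun z => jacobiTheta₂_add_left z (2 * τ)
  simpa using this.int_mul n z

lemma theta_add_mul_tau (τ z : ℂ) (x : ℤ) :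
    theta τ (z + 2 * x * τ) = e (-((x : ℂ) ^ 2 * τ + x * z)) * theta τ z := by
  rw [theta, theta, jacobiTheta₂, jacobiTheta₂, ← tsum_mul_left, ← (Equiv.addRight x).tsum_eq
    (fun r => e (-((x : ℂ) ^ 2 * τ + x * z)) * jacobiTheta₂_term r z (2 * τ))]
  refine tsum_congr fun r => ?_
  rw [jacobiTheta₂_term, jacobiTheta₂_term, e, ← Complex.exp_add]
  congr 1
  simp only [Equiv.coe_addRight]
  push_cast
  ring

lemma hasSum_theta {τ : ℂ} (hτ : 0 < τ.im) (z : ℂ) :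
    HasSum (fun r : ℤ => e ((r : ℂ) ^ 2 * τ) * e (r * z)) (theta τ z) := by
  have him : 0 < (2 * τ).im := by simpa using hτ
  refine (hasSum_jacobiTheta₂_term z him).congr_fun fun r => ?_
  rw [jacobiTheta₂_term, ← e_add, e]
  congr 1
  ring

/-- `∑ ε(r) e(r² τ + r z)`, as a combination of translates of `θ`. -/
noncomputable def twistedTheta {f : ℕ} [NeZero f] (ε : DirichletCharacter ℂ f) (τ z : ℂ) : ℂ :=
  ∑ a : ZMod f, (f : ℂ)⁻¹ * ZMod.dft ε a * theta τ (z + a.val / f)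

/-- The substitution `j ↦ jd` in the finite Fourier transform. This equivariance produces the factor
`ε(d)` without evaluating Gauss sums. -/
lemma dft_mul_unit {f : ℕ} [NeZero f] (ε : DirichletCharacter ℂ f) (d : (ZMod f)ˣ) (a : ZMod f) :
    ZMod.dft ε a = ε d * ZMod.dft ε (a * d) := by
  rw [ZMod.dft_apply, ZMod.dft_apply, Finset.mul_sum, ← Equiv.sum_comp (Units.mulRight d)]
  refine Finset.sum_congr rfl fun j _ => ?_
  simp only [Units.mulRight_apply, smul_eq_mul, map_mul]
  rw [show j * d * a = j * (a * d) by ring]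
  ring

lemma dirichlet_eq_sum {f : ℕ} [NeZero f] (ε : DirichletCharacter ℂ f) (x : ZMod f) :
    ε x = ∑ a : ZMod f, (f : ℂ)⁻¹ * ZMod.dft ε a * ZMod.stdAddChar (a * x) := by
  have h := ZMod.invDFT_apply (ZMod.dft ε) x
  rw [LinearEquiv.symm_apply_apply] at h
  rw [h, smul_eq_mul, Finset.mul_sum]
  refine Finset.sum_congr rfl fun a _ => ?_
  rw [smul_eq_mul]; ring

lemma coe_scale (m : ℕ) [NeZero m] (τ : ℍ) : (scale m τ : ℂ) = 4 * m * τ := rfl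

/-- At `4mτ` the exponent `r²/(4m)` becomes `r²`, so the interleaved series is `∑ ε(r) e(r²τ + rz)`;
expanding `ε` in additive characters turns it into translates of `θ`. -/
lemma sum_char_mul_jacobiTheta {m f : ℕ} [NeZero m] [NeZero f] (hf : f ∣ 2 * m)
    (ε : DirichletCharacter ℂ f) (τ : ℍ) (z : ℂ) :
    ∑ μ : ZMod (2 * m), ε (μ.cast : ZMod f) * jacobiTheta m μ (scale m τ) z =
      twistedTheta ε τ z := by
  have hm : (m : ℂ) ≠ 0 := NeZero.ne _
  have hf0 : (f : ℂ) ≠ 0 := NeZero.ne _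
  refine (hasSum_thetaDecomposition m _ (scale m τ) z).unique ?_
  have h := hasSum_sum (s := Finset.univ) fun (a : ZMod f) _ =>
    (hasSum_theta τ.im_pos (z + a.val / f)).mul_left ((f : ℂ)⁻¹ * ZMod.dft ε a)
  refine h.congr_fun fun r => ?_
  rw [ZMod.cast_intCast hf, dirichlet_eq_sum, Finset.sum_mul, Finset.sum_mul]
  refine Finset.sum_congr rfl fun a _ => ?_
  have ha : a * (r : ZMod f) = ((a.val * r : ℤ) : ZMod f) := by
    push_cast; rw [ZMod.natCast_zmod_val]
  rw [ha, stdAddChar_eq, coe_scale, mul_assoc, mul_assoc, ← e_add, ← e_add, ← e_add]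
  congr 2
  push_cast
  field_simp
  ring

lemma thetaJ_eq (γ : SL(2, ℤ)) (τ : ℍ) :
    thetaJ γ τ = thetaSign (γ 1 0) (γ 1 1) * den γ τ ^ (1 / 2 : ℂ) := rfl

lemma theta_smul {γ : SL(2, ℤ)} (hγ : (4 : ℤ) ∣ γ 1 0) (τ : ℍ) (z : ℂ) :
    theta (γ • τ : ℍ) (z / den γ τ) =
      thetaJ γ τ * e (γ 1 0 * z ^ 2 / (4 * den γ τ)) * theta τ z := by
  rw [thetaJ_eq, coe_smul_eq]
  exact thetaLaw (by linear_combination det_eq_one γ) hγ τ τ.im_pos z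

/-- Shifting `z/(cτ + d)` by `n/f` shifts `z` by `nd/f + ncτ/f`. For `4f² ∣ c` the second term is an
even multiple of `τ`, absorbed by quasi-periodicity; the leftover exponential is `e` of an integer.
-/
lemma theta_smul_add {f : ℕ} [NeZero f] {γ : SL(2, ℤ)} (hγ : (4 * f ^ 2 : ℤ) ∣ γ 1 0) (τ : ℍ)
    (z : ℂ) (n : ℤ) :
    theta (γ • τ : ℍ) (z / den γ τ + n / f) =
      thetaJ γ τ * e (γ 1 0 * z ^ 2 / (4 * den γ τ)) * theta τ (z + (n * γ 1 1 : ℤ) / f) := by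
  have hf0 : (f : ℂ) ≠ 0 := NeZero.ne _
  have hD := den_ne_zero γ τ
  obtain ⟨c, hc⟩ := hγ
  have hz : z / den γ τ + n / f = (z + n * den γ τ / f) / den γ τ := by field_simp
  have hz' : z + n * den γ τ / f =
      (z + (n * γ 1 1 : ℤ) / f) + 2 * ((2 * f * c * n : ℤ) : ℂ) * τ := by
    rw [den, hc]; push_cast; field_simp; ring
  rw [hz, theta_smul ⟨f ^ 2 * c, by rw [hc]; ring⟩]
  conv_lhs => rw [hz', theta_add_mul_tau]
  rw [mul_assoc (thetaJ γ τ), ← mul_assoc (e _), ← e_add, ← mul_assoc]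
  congr 2
  refine e_eq_of_sub (-(c * n ^ 2 * γ 1 1)) ?_
  have hd : den γ τ = γ 1 0 * τ + γ 1 1 := rfl
  rw [hc] at hd ⊢
  generalize den γ τ = D at *
  push_cast at hd ⊢
  field_simp
  linear_combination
    (-(2 * c * f * z * n + c * n ^ 2 * γ 1 1 + 4 * c ^ 2 * f ^ 2 * n ^ 2 * τ)) * hd

/-- The transformation law of the twisted theta function on `Γ₀(4 f²)`. -/
lemma twistedTheta_smul {f : ℕ} [NeZero f] (ε : DirichletCharacter ℂ f) {γ : SL(2, ℤ)}
    (hγ : (4 * f ^ 2 : ℤ) ∣ γ 1 0) (τ : ℍ) (z : ℂ) :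
    twistedTheta ε (γ • τ : ℍ) (z / den γ τ) =
      ε (γ 1 1 : ℤ) * thetaJ γ τ * e (γ 1 0 * z ^ 2 / (4 * den γ τ)) * twistedTheta ε τ z := by
  have hf0 : (f : ℂ) ≠ 0 := NeZero.ne _
  have hcop : IsCoprime (γ 1 1) (f : ℤ) := by
    refine (isCoprime_bottom γ).symm.of_isCoprime_of_dvd_right ?_
    exact Dvd.dvd.trans ⟨4 * f, by ring⟩ hγ
  have hu : IsUnit ((γ 1 1 : ℤ) : ZMod f) := by
    rw [ZMod.coe_int_isUnit_iff_isCoprime]; exact hcop.symm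
  obtain ⟨d, hd⟩ := hu
  -- Reindexing by `a ↦ ad` matches the translates by `ad/f` that `γ` produces.
  rw [twistedTheta, twistedTheta, ← hd, Finset.mul_sum, ← Equiv.sum_comp (Units.mulRight d)
    (fun a => ε d * thetaJ γ τ * e (γ 1 0 * z ^ 2 / (4 * den γ τ)) *
      ((f : ℂ)⁻¹ * ZMod.dft ε a * theta τ (z + a.val / f)))]
  refine Finset.sum_congr rfl fun a _ => ?_
  simp only [Units.mulRight_apply]
  have h1 := theta_smul_add hγ τ z (a.val : ℤ)
  rw [Int.cast_natCast] at h1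
  rw [h1, dft_mul_unit ε d a]
  have h2 : theta τ (z + (a.val * γ 1 1 : ℤ) / f) = theta τ (z + (a * d).val / f) := by
    have : ((a * d : ZMod f).val : ℤ) = (a.val * γ 1 1 : ℤ) % f := by
      rw [← ZMod.val_intCast]
      congr 2
      push_cast
      rw [hd, ZMod.natCast_zmod_val]
    rw [← theta_add_right_int τ (z + (a * d).val / f) ((a.val * γ 1 1 : ℤ) / f)]
    congr 1
    have h3 : ((a.val * γ 1 1 : ℤ) : ℂ) = (a * d : ZMod f).val + f * ((a.val * γ 1 1 / f : ℤ) : ℂ) := by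
      have h4 := Int.mul_ediv_add_emod (a.val * γ 1 1) f
      rw [← this] at h4
      rw [add_comm]
      exact_mod_cast h4.symm
    rw [h3]
    field_simp
    ring
  rw [h2]
  ring

lemma quadSymbol_sq {c d : ℤ} (h : IsCoprime c d) : quadSymbol c d ^ 2 = 1 := by
  have : c.gcd (d.natAbs : ℤ) = 1 := by
    have h1 := Int.isCoprime_iff_gcd_eq_one.mp h
    rwa [Int.gcd, Int.natAbs_natCast]
  rw [quadSymbol, mul_pow, jacobiSym.sq_one this]
  split_ifs <;> simp

/-- The source of `χ_p`: `ε_d⁻²` is `(-1/d)`, so trading powers of `cτ + d` for powers of `j²` costs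
a power of this character. -/
lemma thetaJ_sq {γ : SL(2, ℤ)} (hγ : (4 : ℤ) ∣ γ 1 0) (τ : ℍ) :
    thetaJ γ τ ^ 2 = (ZMod.χ₄ ((γ 1 1 : ℤ) : ZMod 4) : ℂ) * den γ τ := by
  have hodd : γ 1 1 % 2 = 1 := by
    have := det_eq_one γ
    rcases Int.emod_two_eq_zero_or_one (γ 1 1) with h | h
    · exfalso
      obtain ⟨c, hc⟩ := hγ
      obtain ⟨x, hx⟩ := Int.dvd_of_emod_eq_zero h
      rw [hc, hx] at this
      have : 2 * (γ 0 0 * x - 2 * γ 0 1 * c) = 1 := by linear_combination this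
      omega
    · exact h
  rw [thetaJ_eq, mul_pow, cpow_half_sq, thetaSign, mul_pow]
  have := quadSymbol_sq (isCoprime_bottom γ)
  rw [← Int.cast_pow, this]
  congr 1
  rw [epsD]
  rcases (by omega : γ 1 1 % 4 = 1 ∨ γ 1 1 % 4 = 3) with h | h
  · rw [if_pos h, ZMod.χ₄_int_one_mod_four h]; simp
  · rw [if_neg (by omega), ZMod.χ₄_int_three_mod_four h]; simp

lemma norm_chi4_intCast {d : ℤ} (h : Odd d) : ‖(ZMod.χ₄ (d : ZMod 4) : ℂ)‖ = 1 := by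
  have := Int.odd_iff.mp h
  rcases (by omega : d % 4 = 1 ∨ d % 4 = 3) with h | h
  · rw [ZMod.χ₄_int_one_mod_four h]; simp
  · rw [ZMod.χ₄_int_three_mod_four h]; simp

end EichlerZagier

namespace EichlerZagier

open Complex

/-! ### Transformation of the twisted sum of theta components -/

/-- The components of `φ|γ` arise from `h_μ(γτ)` through the transpose of the matrix acting on the
`Θ_μ`. It holds for any `γ`, so it serves both the transformation law and the cusps. -/
lemma jacobiSlash_eq_sum {k : ℤ} {m : ℕ} [NeZero m] {φ : ℍ → ℂ → ℂ} {h : ZMod (2 * m) → ℍ → ℂ}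
    (hh : IsThetaDecomposition m φ h) {γ : SL(2, ℤ)} {τ : ℍ} {s : ℂ}
    {M : Matrix (ZMod (2 * m)) (ZMod (2 * m)) ℂ}
    (hM : ∀ μ z, jacobiSlash 0 m (jacobiTheta m μ) γ τ z = s * ∑ ν, M μ ν * jacobiTheta m ν τ z)
    (z : ℂ) : jacobiSlash k m φ γ τ z =
      ∑ ν, (den γ τ ^ (-k) * s * ∑ μ, h μ (γ • τ) * M μ ν) * jacobiTheta m ν τ z := by
  have h1 : ∀ μ, jacobiTheta m μ (γ • τ) (z / den γ τ) *
      e (-(m : ℂ) * γ 1 0 * z ^ 2 / den γ τ) = s * ∑ ν, M μ ν * jacobiTheta m ν τ z := by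
    intro μ
    rw [← hM, jacobiSlash_eq, neg_zero, zpow_zero, mul_one]
  rw [jacobiSlash_eq, hh, mul_right_comm, mul_comm, Finset.sum_mul]
  simp_rw [mul_assoc (h _ _), h1, Finset.mul_sum, Finset.sum_mul]
  rw [Finset.sum_comm]
  refine Finset.sum_congr rfl fun ν _ => Finset.sum_congr rfl fun μ _ => ?_
  ring

/-- The matrix `(a, 4 m b; c / 4 m, d)`, conjugate of `(a, b; c, d)` by multiplication by `4 m`. -/
def conjScale (m : ℕ) (γ : SL(2, ℤ)) (c : ℤ) (hc : γ 1 0 = 4 * m * c) : SL(2, ℤ) :=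
  ⟨!![γ 0 0, 4 * m * γ 0 1; c, γ 1 1], by
    rw [Matrix.det_fin_two_of]
    linear_combination det_eq_one γ + γ 0 1 * hc⟩

section

variable {m : ℕ} [NeZero m] {γ : SL(2, ℤ)} {c : ℤ} (hc : γ 1 0 = 4 * m * c)

lemma den_conjScale (τ : ℍ) : den (conjScale m γ c hc) (scale m τ) = den γ τ := by
  simp only [den, conjScale, coe_scale, hc]
  simp
  ring

lemma conjScale_smul (τ : ℍ) : conjScale m γ c hc • scale m τ = scale m (γ • τ) := by
  ext
  rw [coe_scale, coe_smul_eq, coe_smul_eq, den_conjScale]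
  simp [conjScale, coe_scale]
  ring

end

lemma norm_thetaJ_sq {γ : SL(2, ℤ)} (hγ : (4 : ℤ) ∣ γ 1 0) (τ : ℍ) :
    ‖thetaJ γ τ‖ ^ 2 = ‖den γ τ‖ := by
  rw [← norm_pow, thetaJ_sq hγ, norm_mul, norm_chi4_intCast, one_mul]
  rw [← Int.not_even_iff_odd, even_iff_two_dvd]
  intro h2
  have : IsUnit (2 : ℤ) :=
    (isCoprime_bottom γ).isUnit_of_dvd' ((by norm_num : (2 : ℤ) ∣ 4).trans hγ) h2
  exact absurd this (by decide)

/-- The vector `(ε(ν))` is an eigenvector of the unitary matrix by which `(a, 4 m b; c / 4 m, d)`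
acts on the theta functions, if `c` is divisible by `4 f²`. -/
lemma char_eigenvector {m f : ℕ} [NeZero m] [NeZero f] (hf : f ∣ 2 * m)
    (ε : DirichletCharacter ℂ f) {γ : SL(2, ℤ)} {c : ℤ} (hc : γ 1 0 = 4 * m * c)
    (hγ : (4 * f ^ 2 : ℤ) ∣ γ 1 0) {τ : ℍ} {s : ℂ} {M : Matrix (ZMod (2 * m)) (ZMod (2 * m)) ℂ}
    (hMu : M ∈ Matrix.unitaryGroup (ZMod (2 * m)) ℂ) (hs : s ^ 2 = den γ τ)
    (hM : ∀ μ z, jacobiSlash 0 m (jacobiTheta m μ) (conjScale m γ c hc) (scale m τ) z =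
      s * ∑ ν, M μ ν * jacobiTheta m ν (scale m τ) z) (κ : ZMod (2 * m)) :
    ε (γ 1 1 : ℤ) * (s * ∑ ν, M κ ν * ε (ν.cast : ZMod f)) =
      thetaJ γ τ * ε (κ.cast : ZMod f) := by
  have h4 : (4 : ℤ) ∣ γ 1 0 := (Dvd.intro _ rfl).trans hγ
  have hm : (m : ℂ) ≠ 0 := NeZero.ne _
  -- The law of the twisted theta series for `ε⁻¹` says that the row vector `(ε⁻¹(μ))` is a left
  -- eigenvector of `M`.
  have hleft : (fun ν => s * ∑ μ, ε⁻¹ (μ.cast : ZMod f) * M μ ν) =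
      fun ν : ZMod (2 * m) => ε⁻¹ (γ 1 1 : ℤ) * thetaJ γ τ * ε⁻¹ (ν.cast : ZMod f) := by
    refine jacobiTheta_coeff_unique (τ := scale m τ) fun z => ?_
    have h1 := twistedTheta_smul ε⁻¹ hγ τ z
    rw [← sum_char_mul_jacobiTheta hf, ← sum_char_mul_jacobiTheta hf, ← conjScale_smul hc,
      ← den_conjScale hc] at h1
    have h2 : ∀ μ, jacobiTheta m μ (conjScale m γ c hc • scale m τ)
        (z / den (conjScale m γ c hc) (scale m τ)) =
        (s * ∑ ν, M μ ν * jacobiTheta m ν (scale m τ) z) *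
          e (γ 1 0 * z ^ 2 / (4 * den (conjScale m γ c hc) (scale m τ))) := by
      intro μ
      rw [← hM, jacobiSlash_eq, neg_zero, zpow_zero, mul_one, mul_assoc, ← e_add]
      have : -(m : ℂ) * (conjScale m γ c hc) 1 0 * z ^ 2 / den (conjScale m γ c hc) (scale m τ) +
          γ 1 0 * z ^ 2 / (4 * den (conjScale m γ c hc) (scale m τ)) = 0 := by
        rw [show (conjScale m γ c hc) 1 0 = c by simp [conjScale], hc]
        push_cast
        field_simp
        ring
      rw [this, e_zero, mul_one]
    simp_rw [h2, ← mul_assoc, ← Finset.sum_mul] at h1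
    rw [mul_right_comm _ (e _)] at h1
    have h3 := mul_right_cancel₀ (e_ne_zero _) h1
    simp_rw [mul_assoc] at h3 ⊢
    rw [← Finset.mul_sum, ← Finset.mul_sum, ← Finset.mul_sum, ← h3]
    simp_rw [Finset.mul_sum, Finset.sum_mul, Finset.mul_sum]
    rw [Finset.sum_comm]
    refine Finset.sum_congr rfl fun ν _ => Finset.sum_congr rfl fun μ _ => ?_
    ring
  have hstar : ∀ x : ZMod f, star (ε⁻¹ x) = ε x := by
    intro x
    rw [← MulChar.star_apply, MulChar.star_eq_inv, inv_inv]
  have hright : ∀ ν, star s * ∑ μ, ε (μ.cast : ZMod f) * star (M μ ν) =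
      ε (γ 1 1 : ℤ) * star (thetaJ γ τ) * ε (ν.cast : ZMod f) := by
    intro ν
    have := congrArg star (congrFun hleft ν)
    simpa only [star_mul', star_sum, hstar] using this
  have hMM : M * star M = 1 := Matrix.mem_unitaryGroup_iff.mp hMu
  -- Conjugating `hleft` turns `ε⁻¹` into `ε`; applying `M` and `M M* = 1` gives a right
  -- eigenvector. The conjugates of `s` and `j` are then removed by `|s|² = |j|² = |cτ + d|`.
  have hmain : star s * ε (κ.cast : ZMod f) =
      ε (γ 1 1 : ℤ) * star (thetaJ γ τ) * ∑ ν, M κ ν * ε (ν.cast : ZMod f) := by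
    have h1 : ∑ ν, M κ ν * (star s * ∑ μ, ε (μ.cast : ZMod f) * star (M μ ν)) =
        star s * ε (κ.cast : ZMod f) := by
      have h2 : ∀ μ, ∑ ν, M κ ν * star (M μ ν) = if κ = μ then 1 else 0 := by
        intro μ
        have := congrFun (congrFun hMM κ) μ
        rw [Matrix.mul_apply, Matrix.one_apply] at this
        simpa [Matrix.star_apply] using this
      simp_rw [Finset.mul_sum]
      rw [Finset.sum_comm]
      have h3 : ∀ μ : ZMod (2 * m), ∑ ν, M κ ν * (star s * (ε (μ.cast : ZMod f) * star (M μ ν))) =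
          star s * ε (μ.cast : ZMod f) * ∑ ν, M κ ν * star (M μ ν) := by
        intro μ
        rw [Finset.mul_sum]
        refine Finset.sum_congr rfl fun ν _ => ?_
        ring
      simp_rw [h3, h2]
      simp
    rw [← h1, Finset.mul_sum]
    refine Finset.sum_congr rfl fun ν _ => ?_
    rw [hright]
    ring
  have hJ : thetaJ γ τ * star (thetaJ γ τ) = s * star s := by
    rw [RCLike.star_def, Complex.mul_conj, Complex.mul_conj, Complex.normSq_eq_norm_sq,
      Complex.normSq_eq_norm_sq, norm_thetaJ_sq h4, ← norm_pow s, hs]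
  have hs0 : star s ≠ 0 := by
    rw [star_ne_zero]
    rintro rfl
    exact den_ne_zero γ τ (by rw [← hs]; simp)
  refine mul_right_cancel₀ hs0 ?_
  calc _ = ε (γ 1 1 : ℤ) * (∑ ν, M κ ν * ε (ν.cast : ZMod f)) * (s * star s) := by ring
    _ = thetaJ γ τ * (ε (γ 1 1 : ℤ) * star (thetaJ γ τ) * ∑ ν, M κ ν * ε (ν.cast : ZMod f)) := by
      rw [← hJ]; ring
    _ = _ := by rw [← hmain]; ring

/-- As `4mN ∣ c`, conjugation by `diag(4m, 1)` sends `γ` into `Γ₀(N)`, where `φ` is invariant up to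
`χ(d)`. Pairing the resulting law of the components with the right eigenvector `(ε(ν))` closes up on
`h_ε`. -/
lemma twistedEZ_smul {k : ℤ} {m N f : ℕ} [NeZero m] [NeZero f] (hf : f ∣ 2 * m)
    {χ : DirichletCharacter ℂ N} {φ : ℍ → ℂ → ℂ} (hφ : IsJacobiForm k m N χ φ)
    {h : ZMod (2 * m) → ℍ → ℂ} (hh : IsThetaDecomposition m φ h) (ε : DirichletCharacter ℂ f)
    {γ : SL(2, ℤ)} (hN : (4 * m * N : ℤ) ∣ γ 1 0) (hγ : (4 * f ^ 2 : ℤ) ∣ γ 1 0) (τ : ℍ) :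
    ε (γ 1 1 : ℤ) * χ (γ 1 1 : ℤ) * twistedEZ m ε h τ =
      den γ τ ^ (-k) * thetaJ γ τ * twistedEZ m ε h (γ • τ) := by
  obtain ⟨c', hc'⟩ := hN
  have hc : γ 1 0 = 4 * m * (N * c') := by rw [hc']; ring
  obtain ⟨M, hMu, hM⟩ := actsUnitarily m (conjScale m γ _ hc)
  obtain ⟨s, hs, hM⟩ := hM (scale m τ)
  rw [den_conjScale] at hs
  have hmem : conjScale m γ _ hc ∈ CongruenceSubgroup.Gamma0 N := by
    rw [CongruenceSubgroup.Gamma0_mem]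
    simp [conjScale]
  have hcomp : (fun ν => χ (γ 1 1 : ℤ) * h ν (scale m τ)) =
      fun ν => den γ τ ^ (-k) * s * ∑ μ, h μ (scale m (γ • τ)) * M μ ν := by
    refine jacobiTheta_coeff_unique (τ := scale m τ) fun z => ?_
    have h1 := hφ.slash_eq _ hmem (scale m τ) z
    rw [jacobiSlash_eq_sum hh hM, den_conjScale, conjScale_smul, hh (scale m τ) z] at h1
    rw [h1, Finset.mul_sum]
    refine Finset.sum_congr rfl fun ν _ => ?_
    simp [conjScale, mul_assoc]
  have heig := char_eigenvector hf ε hc hγ hMu hs hM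
  calc _ = ε (γ 1 1 : ℤ) * ∑ ν, ε (ν.cast : ZMod f) * (χ (γ 1 1 : ℤ) * h ν (scale m τ)) := by
        rw [twistedEZ, Finset.mul_sum, Finset.mul_sum]
        refine Finset.sum_congr rfl fun ν _ => ?_
        ring
    _ = ε (γ 1 1 : ℤ) * ∑ ν, ε (ν.cast : ZMod f) *
          (den γ τ ^ (-k) * s * ∑ μ, h μ (scale m (γ • τ)) * M μ ν) := by
        congr 1
        refine Finset.sum_congr rfl fun ν _ => ?_
        rw [congrFun hcomp ν]
    _ = den γ τ ^ (-k) * ∑ μ, h μ (scale m (γ • τ)) *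
          (ε (γ 1 1 : ℤ) * (s * ∑ ν, M μ ν * ε (ν.cast : ZMod f))) := by
        simp_rw [Finset.mul_sum]
        rw [Finset.sum_comm]
        refine Finset.sum_congr rfl fun ν _ => Finset.sum_congr rfl fun μ _ => ?_
        ring
    _ = _ := by
        simp_rw [heig]
        rw [twistedEZ, Finset.mul_sum, Finset.mul_sum]
        refine Finset.sum_congr rfl fun ν _ => ?_
        ring

/-! ### The nebentypus and the half-integral weight. -/

lemma mulChar_zpow_apply_coe {R : Type*} [CommMonoid R] (ψ : MulChar R ℂ) (k : ℤ) (u : Rˣ) :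
    (ψ ^ k) u = ψ u ^ k := by
  cases k with
  | ofNat n => simp [MulChar.pow_apply_coe]
  | negSucc n => rw [zpow_negSucc, zpow_negSucc, MulChar.inv_apply_eq_inv', MulChar.pow_apply_coe]

lemma nebentypus_apply {k : ℤ} {p N f : ℕ} (χ : DirichletCharacter ℂ N)
    (ε : DirichletCharacter ℂ f) {d : ℤ} (hd : IsCoprime d ((4 * p * N * f : ℕ) : ℤ)) :
    nebentypus k p χ ε (d : ZMod (4 * p * N * f)) =
      ε d * χ d * ((ZMod.χ₄ (d : ZMod 4) : ℂ) ^ k)⁻¹ := by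
  have hd4 : IsCoprime d ((4 * p : ℕ) : ℤ) :=
    hd.of_isCoprime_of_dvd_right (by exact_mod_cast (Dvd.intro N rfl : 4 * p ∣ 4 * p * N).mul_right f)
  rw [nebentypus, MulChar.mul_apply, MulChar.mul_apply,
    DirichletCharacter.changeLevel_eq_cast_of_dvd' _ _ hd,
    DirichletCharacter.changeLevel_eq_cast_of_dvd' _ _ hd, MulChar.inv_apply_eq_inv',
    DirichletCharacter.changeLevel_eq_cast_of_dvd' _ _ hd]
  congr 2
  have hu := ZMod.coe_unitOfIsCoprime d hd4
  rw [chiP, ← hu, mulChar_zpow_apply_coe, hu, DirichletCharacter.changeLevel_eq_cast_of_dvd' _ _ hd4,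
    MulChar.ringHomComp_apply]
  rfl

theorem twistedEZ_slash {k : ℤ} {p N f : ℕ} [NeZero p] [NeZero f] (hf : f ∣ p)
    {χ : DirichletCharacter ℂ N} {φ : ℍ → ℂ → ℂ} (hφ : IsJacobiForm k p N χ φ)
    {h : ZMod (2 * p) → ℍ → ℂ} (hh : IsThetaDecomposition p φ h) (ε : DirichletCharacter ℂ f)
    {γ : SL(2, ℤ)} (hγ : γ ∈ CongruenceSubgroup.Gamma0 (4 * p * N * f)) (τ : ℍ) :
    thetaJ γ τ ^ (-(2 * k - 1)) * twistedEZ p ε h (γ • τ) =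
      nebentypus k p χ ε (γ 1 1 : ℤ) * twistedEZ p ε h τ := by
  have hdvd : ((4 * p * N * f : ℕ) : ℤ) ∣ γ 1 0 := by
    rw [← ZMod.intCast_zmod_eq_zero_iff_dvd]; exact hγ
  have hcop : IsCoprime (γ 1 1) ((4 * p * N * f : ℕ) : ℤ) :=
    (isCoprime_bottom γ).symm.of_isCoprime_of_dvd_right hdvd
  have hN : (4 * p * N : ℤ) ∣ γ 1 0 := by
    refine Dvd.dvd.trans ?_ hdvd
    push_cast
    exact Dvd.intro _ rfl
  -- Since `f ∣ p`, the level `4pNf` is a multiple of `4f²`.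
  have hff : (4 * f ^ 2 : ℤ) ∣ γ 1 0 := by
    refine Dvd.dvd.trans ?_ hdvd
    obtain ⟨q, rfl⟩ := hf
    refine ⟨q * N, ?_⟩
    push_cast; ring
  have h4 : (4 : ℤ) ∣ γ 1 0 := (Dvd.intro _ rfl).trans hff
  have key := twistedEZ_smul (hf.mul_left 2) hφ hh ε hN hff τ
  have hD := den_ne_zero γ τ
  have hJ2 := thetaJ_sq h4 τ
  have hJ : thetaJ γ τ ≠ 0 := by
    intro h0
    have := norm_thetaJ_sq h4 τ
    rw [h0] at this
    exact hD (by simpa using this.symm)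
  -- Split `j^(-(2k-1))` as `(j²)^(-k) j` and evaluate `j²`.
  have hz : thetaJ γ τ ^ (-(2 * k - 1)) =
      ((ZMod.χ₄ ((γ 1 1 : ℤ) : ZMod 4) : ℂ) ^ k)⁻¹ * (den γ τ ^ (-k) * thetaJ γ τ) := by
    rw [show -(2 * k - 1) = 2 * (-k) + 1 by ring, zpow_add₀ hJ, zpow_mul, zpow_one,
      show thetaJ γ τ ^ (2 : ℤ) = thetaJ γ τ ^ 2 from zpow_ofNat _ 2, hJ2, mul_zpow, zpow_neg, mul_assoc]
  rw [hz, nebentypus_apply χ ε hcop, mul_assoc, ← key]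
  ring

end EichlerZagier

namespace EichlerZagier

open Complex UpperHalfPlane

/-! ### Growth at the cusps -/

lemma norm_e_ofReal_mul (t : ℝ) (τ : ℂ) :
    ‖e (t * τ)‖ = Real.exp (-(2 * Real.pi * (t * τ.im))) := by
  rw [norm_e, Complex.im_ofReal_mul]

/-- A `q`-series with exponents at least `δ` decays like `q ^ δ`. -/
lemma exists_bound_of_hasSum {a : ℕ → ℂ} {t : ℕ → ℝ} {δ : ℝ} (hδ : ∀ n, a n ≠ 0 → δ ≤ t n)
    {g : ℍ → ℂ} (hg : ∀ τ : ℍ, HasSum (fun n => a n * e (t n * τ)) (g τ)) :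
    ∃ B : ℝ, ∀ τ : ℍ, 1 ≤ τ.im → ‖g τ‖ ≤ B * Real.exp (-(2 * Real.pi * δ * (τ.im - 1))) := by
  -- Absolute convergence at `τ = i` supplies the constant for all `τ` with imaginary part at least
  -- `1`.
  have hs := (hg UpperHalfPlane.I).summable.norm
  refine ⟨∑' n, ‖a n * e (t n * (UpperHalfPlane.I : ℍ))‖, fun τ hτ => ?_⟩
  have hle : ∀ n, ‖a n * e (t n * τ)‖ ≤ ‖a n * e (t n * (UpperHalfPlane.I : ℍ))‖ *
      Real.exp (-(2 * Real.pi * δ * (τ.im - 1))) := by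
    intro n
    by_cases ha : a n = 0
    · simp [ha]
    rw [norm_mul, norm_mul, norm_e_ofReal_mul, norm_e_ofReal_mul, mul_assoc ‖a n‖, ← Real.exp_add]
    gcongr
    have h1 := mul_nonneg (mul_nonneg Real.two_pi_pos.le (sub_nonneg.mpr (hδ n ha)))
      (sub_nonneg.mpr hτ)
    simp only [UpperHalfPlane.coe_im, UpperHalfPlane.coe_I, Complex.I_im]
    nlinarith
  have hs' := hs.mul_right (Real.exp (-(2 * Real.pi * δ * (τ.im - 1))))
  rw [← (hg τ).tsum_eq, ← tsum_mul_right]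
  exact tsum_of_norm_bounded hs'.hasSum hle

/-- A `q`-series with nonnegative exponents is holomorphic. -/
lemma differentiableOn_of_hasSum {a : ℕ → ℂ} {t : ℕ → ℝ} (ht : ∀ n, a n ≠ 0 → 0 ≤ t n)
    (hg : ∀ τ : ℍ, Summable (fun n => a n * e (t n * τ))) :
    DifferentiableOn ℂ (fun w => ∑' n, a n * e (t n * w)) {w : ℂ | 0 < w.im} := by
  intro w hw
  have hw' : 0 < w.im := hw
  -- The series at `w/2` dominates termwise on the half plane above the height of `w/2`, which is a
  -- neighbourhood of `w`.
  have hw2 : 0 < (w / 2).im := by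
    rw [show (2 : ℂ) = ((2 : ℝ) : ℂ) by simp, Complex.div_ofReal_im]; linarith
  have hs := (hg ⟨w / 2, hw2⟩).norm
  have hopen : IsOpen {v : ℂ | (w / 2).im < v.im} := isOpen_lt continuous_const Complex.continuous_im
  have hmem : w ∈ {v : ℂ | (w / 2).im < v.im} := by
    change (w / 2).im < w.im
    rw [show (2 : ℂ) = ((2 : ℝ) : ℂ) by simp, Complex.div_ofReal_im]; linarith
  have hd := differentiableOn_tsum_of_summable_norm (F := fun n (w : ℂ) => a n * e (t n * w)) hs
    (fun n => by unfold e; fun_prop) hopen (by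
      intro n v hv
      by_cases ha : a n = 0
      · simp [ha]
      rw [norm_mul, norm_mul, norm_e_ofReal_mul, norm_e_ofReal_mul]
      gcongr
      · exact ht n ha
      · exact le_of_lt hv)
  exact (hd.differentiableAt (hopen.mem_nhds hmem)).differentiableWithinAt

lemma norm_sqrtDenom_sq (γ : SL(2, ℤ)) (τ : ℍ) : ‖sqrtDenom γ τ‖ ^ 2 = ‖den γ τ‖ := by
  rw [← norm_pow]
  congr 1
  exact cpow_half_sq _

/-- Positivity of the quadratic form of a Jacobi expansion, with a margin `δ`. -/
def HasExpansionBound (m N : ℕ) (δ : ℝ) (F : ℍ → ℂ → ℂ) : Prop :=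
  ∃ c : ℕ → ℤ → ℂ, HasJacobiExpansion N F c ∧
    ∀ (n : ℕ) (r : ℤ), c n r ≠ 0 → δ ≤ (n : ℝ) / N - (r : ℝ) ^ 2 / (4 * m)

lemma IsJacobiForm.hasExpansionBound {k : ℤ} {m N : ℕ} [NeZero m] [NeZero N]
    {χ : DirichletCharacter ℂ N} {φ : ℍ → ℂ → ℂ} (hφ : IsJacobiForm k m N χ φ) (γ : SL(2, ℤ)) :
    HasExpansionBound m N 0 (jacobiSlash k m φ γ) := by
  obtain ⟨c, hc, hpos⟩ := hφ.expansion γ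
  refine ⟨c, hc, fun n r h => ?_⟩
  have h1 : (N : ℝ) * (r : ℝ) ^ 2 ≤ 4 * m * n := by exact_mod_cast hpos n r h
  have hN : (0 : ℝ) < N := by exact_mod_cast Nat.pos_of_ne_zero (NeZero.ne N)
  have hm : (0 : ℝ) < m := by exact_mod_cast Nat.pos_of_ne_zero (NeZero.ne m)
  rw [sub_nonneg, div_le_div_iff₀ (by positivity) hN]
  linarith

/-- The strict inequality is between integers, so it leaves a gap of at least `1`; dividing by `4mN`
gives the margin, uniform in `n` and `r`. -/
lemma IsJacobiCuspForm.hasExpansionBound {k : ℤ} {m N : ℕ} [NeZero m] [NeZero N]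
    {χ : DirichletCharacter ℂ N} {φ : ℍ → ℂ → ℂ} (hφ : IsJacobiCuspForm k m N χ φ)
    (γ : SL(2, ℤ)) : HasExpansionBound m N (1 / (4 * m * N)) (jacobiSlash k m φ γ) := by
  obtain ⟨c, hc, hpos⟩ := hφ.cusp_expansion γ
  refine ⟨c, hc, fun n r h => ?_⟩
  have h1 : (N : ℝ) * (r : ℝ) ^ 2 + 1 ≤ 4 * m * n := by exact_mod_cast hpos n r h
  have hN : (0 : ℝ) < N := by exact_mod_cast Nat.pos_of_ne_zero (NeZero.ne N)
  have hm : (0 : ℝ) < m := by exact_mod_cast Nat.pos_of_ne_zero (NeZero.ne m)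
  rw [div_sub_div _ _ hN.ne' (by positivity), div_le_div_iff₀ (by positivity) (by positivity)]
  nlinarith [mul_pos hm hN]

lemma IsThetaDecomposition.exists_bound {m N : ℕ} [NeZero m] {δ : ℝ} {F : ℍ → ℂ → ℂ}
    {g : ZMod (2 * m) → ℍ → ℂ} (hF : HasExpansionBound m N δ F) (hg : IsThetaDecomposition m F g)
    (ν : ZMod (2 * m)) :
    ∃ B : ℝ, ∀ τ : ℍ, 1 ≤ τ.im → ‖g ν τ‖ ≤ B * Real.exp (-(2 * Real.pi * δ * (τ.im - 1))) := by
  obtain ⟨c, hc, hpos⟩ := hF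
  refine exists_bound_of_hasSum (a := fun n => c n ν.val)
    (t := fun n => (n : ℝ) / N - ((ν.val : ℤ) : ℝ) ^ 2 / (4 * m)) (fun n h => hpos n _ h) fun τ => ?_
  have := hg.hasSum_component hc ν.val τ
  simp only [Int.cast_natCast, ZMod.natCast_zmod_val] at this
  refine this.congr_fun fun n => ?_
  push_cast
  rfl

/-- The growth of the theta components at the cusps. -/
lemma exists_bound_component {k : ℤ} {m N : ℕ} [NeZero m] {δ : ℝ} {φ : ℍ → ℂ → ℂ}
    {h : ZMod (2 * m) → ℍ → ℂ} (hh : IsThetaDecomposition m φ h) {γ : SL(2, ℤ)}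
    (hF : HasExpansionBound m N δ (jacobiSlash k m φ γ)) (μ : ZMod (2 * m)) :
    ∃ B : ℝ, ∀ τ : ℍ, 1 ≤ τ.im → ‖sqrtDenom γ τ ^ (-(2 * k - 1)) * h μ (γ • τ)‖ ≤
      B * Real.exp (-(2 * Real.pi * δ * (τ.im - 1))) := by
  obtain ⟨M, hMu, hM⟩ := actsUnitarily m γ
  choose s hs hM using hM
  have hg : IsThetaDecomposition m (jacobiSlash k m φ γ)
      (fun ν τ => den γ τ ^ (-k) * s τ * ∑ μ, h μ (γ • τ) * M μ ν) := fun τ z =>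
    jacobiSlash_eq_sum hh (hM τ) z
  choose B hB using hg.exists_bound hF
  refine ⟨∑ ν, B ν * ‖star (M μ ν)‖, fun τ hτ => ?_⟩
  have hMM : M * star M = 1 := Matrix.mem_unitaryGroup_iff.mp hMu
  -- Unitarity inverts the passage to the components of `φ|γ`, recovering `h_μ(γτ)` up to its
  -- automorphy factor.
  have hinv : ∑ ν, (den γ τ ^ (-k) * s τ * ∑ κ, h κ (γ • τ) * M κ ν) * star (M μ ν) =
      den γ τ ^ (-k) * s τ * h μ (γ • τ) := by
    have h2 : ∀ κ, ∑ ν, M κ ν * star (M μ ν) = if κ = μ then 1 else 0 := by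
      intro κ
      have := congrFun (congrFun hMM κ) μ
      rw [Matrix.mul_apply, Matrix.one_apply] at this
      simpa [Matrix.star_apply] using this
    simp_rw [mul_assoc, ← Finset.mul_sum, Finset.sum_mul]
    rw [Finset.sum_comm]
    simp_rw [mul_assoc, ← Finset.mul_sum, h2]
    simp
  have hnorm : ‖sqrtDenom γ τ ^ (-(2 * k - 1)) * h μ (γ • τ)‖ =
      ‖den γ τ ^ (-k) * s τ * h μ (γ • τ)‖ := by
    have hq : ‖s τ‖ = ‖sqrtDenom γ τ‖ := by
      rw [← sq_eq_sq₀ (norm_nonneg _) (norm_nonneg _), norm_sqrtDenom_sq, ← norm_pow, hs]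
    have hq0 : ‖sqrtDenom γ τ‖ ≠ 0 := by
      intro h0
      have := norm_sqrtDenom_sq γ τ
      rw [h0] at this
      exact den_ne_zero γ τ (by simpa using this.symm)
    rw [norm_mul, norm_mul, norm_mul, norm_zpow, norm_zpow, hq, ← norm_sqrtDenom_sq,
      ← zpow_natCast, ← zpow_mul, ← zpow_add_one₀ hq0]
    congr 3
    push_cast
    ring
  rw [hnorm, ← hinv]
  refine (norm_sum_le _ _).trans ?_
  rw [Finset.sum_mul]
  refine Finset.sum_le_sum fun ν _ => ?_
  rw [norm_mul, mul_right_comm (B ν)]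
  exact mul_le_mul_of_nonneg_right (hB ν τ hτ) (norm_nonneg (star (M μ ν)))

/-- `diag(4 m, 1) γ` is the product of an element of `SL(2, ℤ)` and an upper triangular matrix. -/
lemma exists_scale_smul (m : ℕ) [NeZero m] (γ : SL(2, ℤ)) :
    ∃ (γ' : SL(2, ℤ)) (w : ℍ → ℍ) (α D : ℝ), 0 < α ∧ 0 < D ∧ ∀ τ, (w τ).im = α * τ.im ∧
      scale m (γ • τ) = γ' • w τ ∧ den γ τ = D * den γ' (w τ) := by
  have hm0 : (m : ℤ) ≠ 0 := by exact_mod_cast NeZero.ne m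
  have hcop := isCoprime_bottom γ
  have hdet := det_eq_one γ
  set a := γ 0 0
  set b := γ 0 1
  set c := γ 1 0
  set d := γ 1 1
  -- The first column of `diag(4m, 1) γ` is `(4ma, c)`. Divided by its gcd `g` it becomes the first
  -- column of `γ'`, completed by Bézout; what remains is the upper triangular matrix `(g, B; 0, D)`
  -- with `gD = 4m`.
  set g : ℤ := (Int.gcd (4 * m * a) c : ℤ) with hgdef
  have hg : 0 < g := by
    rw [hgdef, Int.natCast_pos, Int.gcd_pos_iff]
    by_contra! hcon
    have ha : a = 0 := by
      rcases mul_eq_zero.mp hcon.1 with h | h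
      · exact absurd h (by positivity)
      · exact h
    rw [ha, hcon.2] at hdet
    simp at hdet
  obtain ⟨a', ha'⟩ : g ∣ 4 * m * a := Int.gcd_dvd_left ..
  obtain ⟨c', hc'⟩ : g ∣ c := Int.gcd_dvd_right ..
  obtain ⟨x, y, hxy⟩ : ∃ x y : ℤ, x * a' + y * c' = 1 := by
    refine ⟨Int.gcdA (4 * m * a) c, Int.gcdB (4 * m * a) c, ?_⟩
    have h1 := Int.gcd_eq_gcd_ab (4 * m * a) c
    rw [← hgdef] at h1
    refine mul_left_cancel₀ hg.ne' ?_
    linear_combination (-Int.gcdA (4 * m * a) c) * ha' - Int.gcdB (4 * m * a) c * hc' - h1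
  set B := x * (4 * m * b) + y * d with hB
  set D := a' * d - c' * (4 * m * b) with hD
  have hgD : g * D = 4 * m := by
    rw [hD]; linear_combination (-d) * ha' + 4 * m * b * hc' + 4 * m * hdet
  have hDpos : 0 < D := by
    have : 0 < g * D := by rw [hgD]; positivity
    exact pos_of_mul_pos_right this hg.le
  have hgR : (0 : ℝ) < g := by exact_mod_cast hg
  have hDR : (0 : ℝ) < D := by exact_mod_cast hDpos
  have hDC : (D : ℂ) ≠ 0 := by exact_mod_cast hDpos.ne'
  have him : ∀ τ : ℍ, (((g : ℂ) * τ + B) / D).im = g / D * τ.im := by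
    intro τ
    rw [show (D : ℂ) = ((D : ℝ) : ℂ) by simp, Complex.div_ofReal_im]
    simp [Complex.mul_im]
    ring
  let w : ℍ → ℍ := fun τ => ⟨((g : ℂ) * τ + B) / D, by
    rw [him]; have := τ.im_pos; positivity⟩
  let γ' : SL(2, ℤ) := ⟨!![a', -y; c', x], by
    rw [Matrix.det_fin_two_of]; linear_combination hxy⟩
  have hxyC : (x : ℂ) * a' + y * c' = 1 := by exact_mod_cast hxy
  have hgDC : (g : ℂ) * D = 4 * m := by exact_mod_cast hgD
  have haC : (4 : ℂ) * m * a = g * a' := by exact_mod_cast ha'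
  have hcC : (c : ℂ) = g * c' := by exact_mod_cast hc'
  have hBC : (B : ℂ) = x * (4 * m * b) + y * d := by rw [hB]; push_cast; ring
  have hDeq : (D : ℂ) = a' * d - c' * (4 * m * b) := by rw [hD]; push_cast; ring
  have hw : ∀ τ, ((w τ : ℍ) : ℂ) = ((g : ℂ) * τ + B) / D := fun τ => rfl
  have hden : ∀ τ, den γ τ = D * den γ' (w τ) := by
    intro τ
    have h1 : den γ' (w τ) = c' * w τ + x := by simp [den, γ']
    have h2 : den γ τ = c * τ + d := rfl
    rw [h1, h2, hw]
    field_simp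
    rw [hBC]
    linear_combination τ * hcC - x * hDeq - d * hxyC
  refine ⟨γ', w, g / D, D, by positivity, hDR, fun τ => ⟨him τ, ?_, by exact_mod_cast hden τ⟩⟩
  ext
  have h0 := den_ne_zero γ' (w τ)
  rw [coe_scale, coe_smul_eq, coe_smul_eq, hden]
  have h1 : ((γ' 0 0 : ℤ) : ℂ) = a' := by simp [γ']
  have h2 : ((γ' 0 1 : ℤ) : ℂ) = -y := by simp [γ']
  rw [h1, h2, hw]
  field_simp
  change 4 * (m : ℂ) * (a * τ + b) = _
  rw [hBC]
  linear_combination τ * haC + y * hDeq - 4 * m * b * hxyC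

/-- The behaviour of `h_μ(4mτ)` at the cusp `γ∞` is that of `h_μ` at `γ'∞`, with the height scaled
by `α`; the constant `D` only rescales the automorphy factor. -/
lemma exists_bound_twistedEZ {k : ℤ} {m N f : ℕ} [NeZero m] {δ : ℝ} {φ : ℍ → ℂ → ℂ}
    {h : ZMod (2 * m) → ℍ → ℂ} (hh : IsThetaDecomposition m φ h)
    (hF : ∀ γ, HasExpansionBound m N δ (jacobiSlash k m φ γ)) (ε : DirichletCharacter ℂ f)
    (γ : SL(2, ℤ)) :
    ∃ α C : ℝ, 0 < α ∧ ∀ τ : ℍ, 1 ≤ α * τ.im →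
      ‖sqrtDenom γ τ ^ (-(2 * k - 1)) * twistedEZ m ε h (γ • τ)‖ ≤
        C * Real.exp (-(2 * Real.pi * δ * (α * τ.im - 1))) := by
  obtain ⟨γ', w, α, D, hα, hD, hw⟩ := exists_scale_smul m γ
  choose B hB using fun μ => exists_bound_component hh (hF γ') μ
  refine ⟨α, ∑ μ : ZMod (2 * m), ‖ε (μ.cast : ZMod f)‖ * (√D ^ (-(2 * k - 1)) * B μ), hα,
    fun τ hτ => ?_⟩
  obtain ⟨him, hsc, hden⟩ := hw τ
  have hsq : ‖sqrtDenom γ τ‖ = √D * ‖sqrtDenom γ' (w τ)‖ := by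
    rw [← sq_eq_sq₀ (norm_nonneg _) (by positivity), mul_pow, norm_sqrtDenom_sq, norm_sqrtDenom_sq,
      hden, norm_mul, Real.sq_sqrt hD.le, Complex.norm_real, Real.norm_of_nonneg hD.le]
  rw [twistedEZ, Finset.mul_sum, Finset.sum_mul]
  refine (norm_sum_le _ _).trans (Finset.sum_le_sum fun μ _ => ?_)
  have h1 := hB μ (w τ) (by rwa [him])
  rw [him, norm_mul, norm_zpow] at h1
  rw [hsc, norm_mul, norm_mul, norm_zpow, hsq, mul_zpow]
  calc _ = ‖ε (μ.cast : ZMod f)‖ * (√D ^ (-(2 * k - 1)) *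
        (‖sqrtDenom γ' (w τ)‖ ^ (-(2 * k - 1)) * ‖h μ (γ' • w τ)‖)) := by ring
    _ ≤ ‖ε (μ.cast : ZMod f)‖ * (√D ^ (-(2 * k - 1)) *
        (B μ * Real.exp (-(2 * Real.pi * δ * (α * τ.im - 1))))) := by gcongr
    _ = _ := by ring

lemma mdifferentiable_twistedEZ {m N f : ℕ} [NeZero m] {φ : ℍ → ℂ → ℂ}
    {h : ZMod (2 * m) → ℍ → ℂ} (hh : IsThetaDecomposition m φ h) (hF : HasExpansionBound m N 0 φ)
    (ε : DirichletCharacter ℂ f) : MDifferentiable 𝓘(ℂ) 𝓘(ℂ) (twistedEZ m ε h) := by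
  obtain ⟨c, hc, hpos⟩ := hF
  rw [UpperHalfPlane.mdifferentiable_iff]
  let t : ZMod (2 * m) → ℕ → ℝ := fun μ n => (n : ℝ) / N - ((μ.val : ℤ) : ℝ) ^ 2 / (4 * m)
  have hsum : ∀ μ (τ : ℍ), HasSum (fun n => c n μ.val * e (t μ n * τ)) (h μ τ) := by
    intro μ τ
    have := hh.hasSum_component hc μ.val τ
    simp only [Int.cast_natCast, ZMod.natCast_zmod_val] at this
    refine this.congr_fun fun n => ?_
    simp only [t]
    push_cast
    rfl
  have hd : ∀ μ, DifferentiableOn ℂ (fun w : ℂ => ∑' n, c n μ.val * e (t μ n * (4 * m * w)))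
      {w : ℂ | 0 < w.im} := by
    intro μ
    have := differentiableOn_of_hasSum (a := fun n => c n μ.val) (t := t μ)
      (fun n hn => hpos n _ hn) (fun τ => (hsum μ τ).summable)
    refine this.comp (f := fun w : ℂ => 4 * m * w) (by fun_prop) fun w hw => ?_
    exact (scale m ⟨w, hw⟩).im_pos
  refine (DifferentiableOn.fun_sum (u := Finset.univ) fun μ _ =>
    (hd μ).const_mul (ε (μ.cast : ZMod f))).congr fun w hw => ?_
  simp only [Function.comp_apply, UpperHalfPlane.ofComplex_apply_of_im_pos hw, twistedEZ]
  refine Finset.sum_congr rfl fun μ _ => ?_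
  rw [← (hsum μ (scale m ⟨w, hw⟩)).tsum_eq]
  rfl

theorem isHalfIntegralModularForm_twistedEZ {k : ℤ} {p N f : ℕ} [NeZero p] [NeZero N] [NeZero f]
    (hf : f ∣ p) {χ : DirichletCharacter ℂ N} {φ : ℍ → ℂ → ℂ} (hφ : IsJacobiForm k p N χ φ)
    {h : ZMod (2 * p) → ℍ → ℂ} (hh : IsThetaDecomposition p φ h) (ε : DirichletCharacter ℂ f) :
    IsHalfIntegralModularForm (2 * k - 1) (4 * p * N * f) (nebentypus k p χ ε)
      (twistedEZ p ε h) where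
  holomorphic := mdifferentiable_twistedEZ hh
    (by simpa only [jacobiSlash_one] using hφ.hasExpansionBound 1) ε
  slash_eq γ hγ τ := twistedEZ_slash hf hφ hh ε hγ τ
  bounded_at_cusps γ := by
    obtain ⟨α, C, hα, hC⟩ := exists_bound_twistedEZ hh hφ.hasExpansionBound ε γ
    rw [UpperHalfPlane.isBoundedAtImInfty_iff]
    refine ⟨C, 1 / α, fun τ hτ => ?_⟩
    have := hC τ (by rwa [div_le_iff₀' hα] at hτ)
    simpa using this

theorem isHalfIntegralCuspForm_twistedEZ {k : ℤ} {p N f : ℕ} [NeZero p] [NeZero N] [NeZero f]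
    (hf : f ∣ p) {χ : DirichletCharacter ℂ N} {φ : ℍ → ℂ → ℂ} (hφ : IsJacobiCuspForm k p N χ φ)
    {h : ZMod (2 * p) → ℍ → ℂ} (hh : IsThetaDecomposition p φ h) (ε : DirichletCharacter ℂ f) :
    IsHalfIntegralCuspForm (2 * k - 1) (4 * p * N * f) (nebentypus k p χ ε)
      (twistedEZ p ε h) where
  toIsHalfIntegralModularForm := isHalfIntegralModularForm_twistedEZ hf hφ.toIsJacobiForm hh ε
  zero_at_cusps γ := by
    obtain ⟨α, C, hα, hC⟩ := exists_bound_twistedEZ hh hφ.hasExpansionBound ε γ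
    have hp : (0 : ℝ) < p := by exact_mod_cast Nat.pos_of_ne_zero (NeZero.ne p)
    have hN : (0 : ℝ) < N := by exact_mod_cast Nat.pos_of_ne_zero (NeZero.ne N)
    set δ : ℝ := 1 / (4 * p * N) with hδ
    have hδ0 : 0 < δ := by positivity
    have him : Filter.Tendsto UpperHalfPlane.im UpperHalfPlane.atImInfty Filter.atTop :=
      Filter.tendsto_comap
    have ht : Filter.Tendsto (fun τ : ℍ => C * Real.exp (-(2 * Real.pi * δ * (α * τ.im - 1))))
        UpperHalfPlane.atImInfty (nhds 0) := by
      rw [← mul_zero C]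
      refine Filter.Tendsto.const_mul C (Real.tendsto_exp_neg_atTop_nhds_zero.comp ?_)
      refine Filter.Tendsto.const_mul_atTop (by positivity) ?_
      exact Filter.tendsto_atTop_add_const_right _ (-1) (him.const_mul_atTop hα)
    refine squeeze_zero_norm' ?_ ht
    filter_upwards [him.eventually_ge_atTop (1 / α)] with τ hτ
    exact hC τ (by rwa [div_le_iff₀' hα] at hτ)

end EichlerZagier

namespace EichlerZagier

open Complex

/-! ### Nonvanishing -/

lemma sum_jacobiTheta_neg {m : ℕ} [NeZero m] (x : ZMod (2 * m) → ℂ) (τ : ℍ) (z : ℂ) :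
    ∑ μ, x μ * jacobiTheta m μ τ (-z) = ∑ μ, x (-μ) * jacobiTheta m μ τ z := by
  refine (hasSum_thetaDecomposition m x τ (-z)).unique ?_
  have := hasSum_thetaDecomposition m (fun μ => x (-μ)) τ z
  rw [← (Equiv.neg ℤ).hasSum_iff] at this
  refine this.congr_fun fun r => ?_
  simp

/-- The symmetry of the theta components under `μ ↦ -μ`. -/
lemma component_neg {k : ℤ} {m N : ℕ} [NeZero m] {χ : DirichletCharacter ℂ N} {φ : ℍ → ℂ → ℂ}
    (hφ : IsJacobiForm k m N χ φ) {h : ZMod (2 * m) → ℍ → ℂ} (hh : IsThetaDecomposition m φ h)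
    (μ : ZMod (2 * m)) (τ : ℍ) : h (-μ) τ = χ (-1) * (-1) ^ k * h μ τ := by
  have hmem : (-1 : SL(2, ℤ)) ∈ CongruenceSubgroup.Gamma0 N := by
    rw [CongruenceSubgroup.Gamma0_mem]; simp
  have key : (fun μ => h (-μ) τ) = fun μ => χ (-1) * (-1) ^ k * h μ τ := by
    refine jacobiTheta_coeff_unique (τ := τ) fun z => ?_
    have h1 := hφ.slash_eq _ hmem τ z
    have hd : den (-1) τ = -1 := by simp [den]
    rw [jacobiSlash_eq, hd] at h1
    have h2 : (-1 : SL(2, ℤ)) • τ = τ := by simp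
    rw [h2, hh, hh τ z, div_neg, div_one, sum_jacobiTheta_neg (fun μ => h μ τ)] at h1
    have h3 : ((-1 : SL(2, ℤ)) 1 0 : ℂ) = 0 := by simp
    have h4 : (((-1 : SL(2, ℤ)) 1 1 : ℤ) : ZMod N) = -1 := by simp
    rw [h3, h4] at h1
    have h5 : ((-1 : ℂ) ^ (-k)) * (-1) ^ k = 1 := by
      rw [← zpow_add₀ (by simp)]; simp
    simp only [mul_zero, zero_mul, zero_div, e_zero, mul_one] at h1
    calc _ = (∑ μ, h (-μ) τ * jacobiTheta m μ τ z) * ((-1 : ℂ) ^ (-k) * (-1) ^ k) := by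
          rw [h5, mul_one]
      _ = χ (-1) * (∑ μ, h μ τ * jacobiTheta m μ τ z) * (-1) ^ k := by rw [← mul_assoc, h1]
      _ = _ := by
        rw [Finset.mul_sum, Finset.sum_mul]
        refine Finset.sum_congr rfl fun ν _ => ?_
        ring
  exact congrFun key μ

/-- Translation multiplies `Θ_μ` by `e(nμ²/4m)`, so the component of a function unchanged by it must
absorb the inverse phase. -/
lemma component_add_int {m : ℕ} [NeZero m] {F : ℍ → ℂ → ℂ} {g : ZMod (2 * m) → ℍ → ℂ}
    (hg : IsThetaDecomposition m F g) {τ τ' : ℍ} {n : ℤ} (hτ : (τ' : ℂ) = τ + n)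
    (hF : ∀ z, F τ' z = F τ z) (μ : ZMod (2 * m)) :
    e (n * (μ.val : ℂ) ^ 2 / (4 * m)) * g μ τ' = g μ τ := by
  have key : (fun μ : ZMod (2 * m) => e (n * (μ.val : ℂ) ^ 2 / (4 * m)) * g μ τ') =
      fun μ => g μ τ := by
    refine jacobiTheta_coeff_unique (τ := τ) fun z => ?_
    rw [← hg τ z, ← hF, hg τ' z]
    refine Finset.sum_congr rfl fun ν _ => ?_
    rw [jacobiTheta_add_int m ν n hτ]
    ring
  exact congrFun key μ

lemma coe_T_zpow_smul (n : ℤ) (τ : ℍ) : ((ModularGroup.T ^ n • τ : ℍ) : ℂ) = τ + n := by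
  rw [UpperHalfPlane.modular_T_zpow_smul]
  simp [add_comm]

lemma jacobiSlash_T_zpow (k : ℤ) (m : ℕ) (φ : ℍ → ℂ → ℂ) (n : ℤ) (τ : ℍ) (z : ℂ) :
    jacobiSlash k m φ (ModularGroup.T ^ n) τ z = φ (ModularGroup.T ^ n • τ) z := by
  have hd : den (ModularGroup.T ^ n) τ = 1 := by simp [den, ModularGroup.coe_T_zpow]
  rw [jacobiSlash_eq, hd]
  simp [ModularGroup.coe_T_zpow]

lemma IsJacobiForm.apply_T_zpow {k : ℤ} {m N : ℕ} {χ : DirichletCharacter ℂ N} {φ : ℍ → ℂ → ℂ}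
    (hφ : IsJacobiForm k m N χ φ) (n : ℤ) (τ : ℍ) (z : ℂ) :
    φ (ModularGroup.T ^ n • τ) z = φ τ z := by
  have hmem : ModularGroup.T ^ n ∈ CongruenceSubgroup.Gamma0 N := by
    rw [CongruenceSubgroup.Gamma0_mem]; simp [ModularGroup.coe_T_zpow]
  have := hφ.slash_eq _ hmem τ z
  rw [jacobiSlash_T_zpow] at this
  simpa [ModularGroup.coe_T_zpow] using this

/-- The different exponents modulo `4 m` in the `q`-expansions of the theta components can be
separated. -/
lemma sum_filter_component_eq_zero {k : ℤ} {m N : ℕ} [NeZero m] {χ : DirichletCharacter ℂ N}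
    {φ : ℍ → ℂ → ℂ} (hφ : IsJacobiForm k m N χ φ) {h : ZMod (2 * m) → ℍ → ℂ}
    (hh : IsThetaDecomposition m φ h) (x : ZMod (2 * m) → ℂ)
    (hx : ∀ τ, ∑ μ, x μ * h μ τ = 0) (ν : ZMod (2 * m)) (τ : ℍ) :
    ∑ μ with (4 * m : ℤ) ∣ (ν.val : ℤ) ^ 2 - (μ.val : ℤ) ^ 2, x μ * h μ τ = 0 := by
  have hm : (m : ℂ) ≠ 0 := NeZero.ne _
  have hshift : ∀ (n : ℤ) (μ : ZMod (2 * m)),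
      h μ (ModularGroup.T ^ n • τ) = e (-(n * (μ.val : ℂ) ^ 2 / (4 * m))) * h μ τ := by
    intro n μ
    rw [← component_add_int hh (coe_T_zpow_smul n τ) (fun z => hφ.apply_T_zpow n τ z) μ,
      ← mul_assoc, ← e_add]
    simp
  -- The relation at `τ + n`, normalised by the phase of `ν`; summing over `n` modulo `4m`,
  -- orthogonality keeps just the `μ` with `μ² ≡ ν²` modulo `4m`.
  have h1 : ∀ n : ZMod (4 * m), ∑ μ : ZMod (2 * m), ZMod.stdAddChar
      (n * (((ν.val : ℤ) ^ 2 - (μ.val : ℤ) ^ 2 : ℤ) : ZMod (4 * m))) * (x μ * h μ τ) = 0 := by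
    intro n
    have h2 := hx (ModularGroup.T ^ (n.val : ℤ) • τ)
    rw [← mul_zero (e ((n.val : ℂ) * (ν.val : ℂ) ^ 2 / (4 * m))), ← h2, Finset.mul_sum]
    refine Finset.sum_congr rfl fun μ _ => ?_
    have h3 : n * (((ν.val : ℤ) ^ 2 - (μ.val : ℤ) ^ 2 : ℤ) : ZMod (4 * m)) =
        ((n.val * ((ν.val : ℤ) ^ 2 - (μ.val : ℤ) ^ 2) : ℤ) : ZMod (4 * m)) := by
      push_cast
      rw [ZMod.natCast_zmod_val n]
    rw [h3, stdAddChar_eq, hshift]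
    have h4 : e (((n.val * ((ν.val : ℤ) ^ 2 - (μ.val : ℤ) ^ 2) : ℤ) : ℂ) / ((4 * m : ℕ) : ℂ)) =
        e ((n.val : ℂ) * (ν.val : ℂ) ^ 2 / (4 * m)) *
          e (-(((n.val : ℤ) : ℂ) * (μ.val : ℂ) ^ 2 / (4 * m))) := by
      rw [← e_add]
      congr 1
      push_cast
      field_simp
      ring
    rw [h4]
    ring
  have h5 := Finset.sum_eq_zero (s := Finset.univ) fun n _ => h1 n
  rw [Finset.sum_comm] at h5
  simp_rw [← Finset.sum_mul, AddChar.sum_mulShift _ (ZMod.isPrimitive_stdAddChar _),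
    ZMod.intCast_zmod_eq_zero_iff_dvd] at h5
  rw [Finset.sum_filter]
  have h6 : (((Fintype.card (ZMod (4 * m)) : ℕ) : ℂ)) ≠ 0 := by
    rw [ZMod.card]; push_cast; simp [hm]
  refine mul_left_cancel₀ h6 ?_
  rw [mul_zero]
  refine Eq.trans ?_ h5
  rw [Finset.mul_sum]
  refine Finset.sum_congr rfl fun μ _ => ?_
  push_cast
  split_ifs <;> simp

lemma scale_surjective (m : ℕ) [NeZero m] (τ : ℍ) : ∃ τ', scale m τ' = τ := by
  have hm : (m : ℂ) ≠ 0 := NeZero.ne _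
  have hm' : 0 < m := Nat.pos_of_ne_zero (NeZero.ne m)
  refine ⟨⟨τ / (4 * m), ?_⟩, ?_⟩
  · rw [show (4 * m : ℂ) = ((4 * m : ℝ) : ℂ) by push_cast; rfl, Complex.div_ofReal_im]
    have := τ.im_pos
    exact div_pos this (by positivity)
  · ext
    rw [coe_scale]
    change 4 * (m : ℂ) * (τ / (4 * m)) = τ
    field_simp

/-- The factors `ν - μ` and `ν + μ` have the same parity, hence are both even, and the odd prime `p`
divides one of them, so `2p` does. -/
lemma eq_or_eq_neg_of_dvd {p : ℕ} [Fact p.Prime] (hp : p ≠ 2) {μ ν : ZMod (2 * p)}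
    (h : (4 * p : ℤ) ∣ (ν.val : ℤ) ^ 2 - (μ.val : ℤ) ^ 2) : μ = ν ∨ μ = -ν := by
  have hpp : p.Prime := Fact.out
  have hpI : Prime (p : ℤ) := Nat.prime_iff_prime_int.mp hpp
  have hcop : IsCoprime (2 : ℤ) p := by
    rw [← Nat.cast_ofNat (n := 2), Nat.isCoprime_iff_coprime]
    exact (Nat.coprime_primes Nat.prime_two hpp).mpr hp.symm
  have hfac : (ν.val : ℤ) ^ 2 - (μ.val : ℤ) ^ 2 = (ν.val - μ.val) * (ν.val + μ.val) := by ring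
  have hp1 : (p : ℤ) ∣ (ν.val - μ.val) * (ν.val + μ.val) := by
    rw [← hfac]; exact (Dvd.intro_left 4 rfl).trans h
  have h2 : (2 : ℤ) ∣ (ν.val - μ.val) * (ν.val + μ.val) := by
    rw [← hfac]; exact Dvd.dvd.trans ⟨2 * p, by ring⟩ h
  have h2' : (2 : ℤ) ∣ (ν.val : ℤ) - μ.val := by
    rcases Int.prime_two.dvd_or_dvd h2 with h | h <;> omega
  rcases hpI.dvd_or_dvd hp1 with h3 | h3
  · left
    have h4 := hcop.mul_dvd h2' h3
    have h5 := (ZMod.intCast_zmod_eq_zero_iff_dvd ((ν.val : ℤ) - μ.val) (2 * p)).mpr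
      (by exact_mod_cast h4)
    push_cast at h5
    rw [ZMod.natCast_zmod_val, ZMod.natCast_zmod_val] at h5
    exact (sub_eq_zero.mp h5).symm
  · right
    have h4 := hcop.mul_dvd (by omega : (2 : ℤ) ∣ (ν.val : ℤ) + μ.val) h3
    have h5 := (ZMod.intCast_zmod_eq_zero_iff_dvd ((ν.val : ℤ) + μ.val) (2 * p)).mpr
      (by exact_mod_cast h4)
    push_cast at h5
    rw [ZMod.natCast_zmod_val, ZMod.natCast_zmod_val] at h5
    exact eq_neg_of_add_eq_zero_right h5

lemma cast_neg_apply {m f : ℕ} (hf : f ∣ 2 * m) (ε : DirichletCharacter ℂ f) (μ : ZMod (2 * m)) :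
    ε ((-μ).cast : ZMod f) = ε (-1) * ε (μ.cast : ZMod f) := by
  rw [ZMod.cast_neg hf, neg_eq_neg_one_mul, map_mul]

lemma char_neg_one_mul_self {f : ℕ} (ε : DirichletCharacter ℂ f) : ε (-1) * ε (-1) = 1 := by
  rw [← map_mul]; simp

lemma neg_one_zpow_mul_self (k : ℤ) : (-1 : ℂ) ^ k * (-1) ^ k = 1 := by
  rw [← mul_zpow]; simp

/-- If the parities do not match, then the twisted sum vanishes. -/
lemma twistedEZ_eq_zero {k : ℤ} {m N f : ℕ} [NeZero m] (hf : f ∣ 2 * m)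
    {χ : DirichletCharacter ℂ N} {φ : ℍ → ℂ → ℂ} (hφ : IsJacobiForm k m N χ φ)
    {h : ZMod (2 * m) → ℍ → ℂ} (hh : IsThetaDecomposition m φ h) {ε : DirichletCharacter ℂ f}
    (hne : ε (-1) ≠ χ (-1) * (-1) ^ k) : twistedEZ m ε h = 0 := by
  funext τ
  have h1 : twistedEZ m ε h τ = ε (-1) * (χ (-1) * (-1) ^ k) * twistedEZ m ε h τ := by
    conv_lhs => rw [twistedEZ, ← Equiv.sum_comp (Equiv.neg _)]
    rw [twistedEZ, Finset.mul_sum]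
    refine Finset.sum_congr rfl fun μ _ => ?_
    rw [Equiv.neg_apply, cast_neg_apply hf, component_neg hφ hh]
    ring
  by_contra h0
  have h2 : ε (-1) * (χ (-1) * (-1) ^ k) = 1 := by
    refine mul_right_cancel₀ h0 ?_
    rw [one_mul]; exact h1.symm
  apply hne
  have h3 : χ (-1) * (-1) ^ k * (χ (-1) * (-1) ^ k) = 1 := by
    rw [mul_mul_mul_comm, char_neg_one_mul_self, neg_one_zpow_mul_self, one_mul]
  linear_combination (-ε (-1)) * h3 + (χ (-1) * (-1) ^ k) * h2

/-- If the twisted sum vanishes although the parities match, then so does each of its terms. -/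
lemma char_mul_component_eq_zero {k : ℤ} {p N f : ℕ} [Fact p.Prime] (hp : p ≠ 2)
    (hf : f ∣ 2 * p) {χ : DirichletCharacter ℂ N} {φ : ℍ → ℂ → ℂ} (hφ : IsJacobiForm k p N χ φ)
    {h : ZMod (2 * p) → ℍ → ℂ} (hh : IsThetaDecomposition p φ h) {ε : DirichletCharacter ℂ f}
    (heq : ε (-1) = χ (-1) * (-1) ^ k) (h0 : twistedEZ p ε h = 0) (ν : ZMod (2 * p)) (τ : ℍ) :
    ε (ν.cast : ZMod f) * h ν τ = 0 := by
  have hsum : ∀ τ, ∑ μ : ZMod (2 * p), ε (μ.cast : ZMod f) * h μ τ = 0 := by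
    intro τ
    obtain ⟨τ', rfl⟩ := scale_surjective p τ
    exact congrFun h0 τ'
  have key := sum_filter_component_eq_zero hφ hh _ hsum ν τ
  have hterm : ∀ μ ∈ ({μ : ZMod (2 * p) | (4 * p : ℤ) ∣ (ν.val : ℤ) ^ 2 - (μ.val : ℤ) ^ 2} : Finset _),
      ε (μ.cast : ZMod f) * h μ τ = ε (ν.cast : ZMod f) * h ν τ := by
    intro μ hμ
    rw [Finset.mem_filter] at hμ
    rcases eq_or_eq_neg_of_dvd hp hμ.2 with rfl | rfl
    · rfl
    · rw [cast_neg_apply hf, component_neg hφ hh, ← heq]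
      linear_combination (ε (ν.cast : ZMod f) * h ν τ) * char_neg_one_mul_self ε
  -- With matching parities the terms at `ν` and `-ν` agree, so the filtered sum is a positive
  -- integer times the term at `ν`.
  rw [Finset.sum_congr rfl hterm, Finset.sum_const, nsmul_eq_mul] at key
  refine (mul_eq_zero.mp key).resolve_left ?_
  refine Nat.cast_ne_zero.mpr ?_
  refine Finset.card_ne_zero_of_mem (a := ν) ?_
  simp

/-- A Jacobi form of prime index whose theta components `h_μ` vanish for all `μ` prime to the
index is zero. -/
lemma eq_zero_of_component_eq_zero {k : ℤ} {p N : ℕ} [Fact p.Prime] (hp : p ≠ 2)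
    (hN : p.Coprime N) {χ : DirichletCharacter ℂ N} {φ : ℍ → ℂ → ℂ} (hφ : IsJacobiForm k p N χ φ)
    {h : ZMod (2 * p) → ℍ → ℂ} (hh : IsThetaDecomposition p φ h)
    (h0 : ∀ ν : ZMod (2 * p), ¬ p ∣ ν.val → ∀ τ, h ν τ = 0) : φ = 0 := by
  have hpp : p.Prime := Fact.out
  have hpc : (p : ℂ) ≠ 0 := NeZero.ne _
  have hp3 : 3 ≤ p := by have := hpp.two_le; omega
  choose u hu0 hu2 hu using exists_jacobiSlash_S_jacobiTheta p
  let F := jacobiSlash k p φ ModularGroup.S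
  let g : ZMod (2 * p) → ℍ → ℂ := fun ν τ => den ModularGroup.S τ ^ (-k) * (u τ)⁻¹ *
    ∑ μ, h μ (ModularGroup.S • τ) * ZMod.stdAddChar (-(μ * ν))
  have hg : IsThetaDecomposition p F g := fun τ z =>
    jacobiSlash_eq_sum (M := Matrix.of fun μ ν : ZMod (2 * p) => ZMod.stdAddChar (-(μ * ν))) hh
      (by simpa using hu τ) z
  -- Only `μ` divisible by `p` contribute, and for these `2μ = 0` modulo `2p`.
  have hper : ∀ ν τ, g (ν + 2) τ = g ν τ := by
    intro ν τ
    simp only [g]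
    congr 1
    refine Finset.sum_congr rfl fun μ _ => ?_
    by_cases hμ : p ∣ μ.val
    · congr 2
      have : μ * 2 = 0 := by
        obtain ⟨q, hq⟩ := hμ
        rw [← ZMod.natCast_zmod_val μ, hq]
        have h1 : ((2 * p : ℕ) : ZMod (2 * p)) = 0 := ZMod.natCast_self _
        push_cast at h1 ⊢
        linear_combination (q : ZMod (2 * p)) * h1
      rw [mul_add, this, add_zero]
    · rw [h0 μ hμ, zero_mul, zero_mul]
  -- `S T^N S⁻¹` is the lower triangular matrix `V`, which lies in `Γ₀(N)` and has `d = 1`.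
  have hFN : ∀ τ z, F (ModularGroup.T ^ (N : ℤ) • τ) z = F τ z := by
    intro τ z
    let V : SL(2, ℤ) := ⟨!![1, 0; -(N : ℤ), 1], by simp⟩
    have hV : V ∈ CongruenceSubgroup.Gamma0 N ∧ V 1 1 = 1 := by
      rw [CongruenceSubgroup.Gamma0_mem]
      simp [V]
    have hφV : jacobiSlash k p φ V = φ := by
      funext τ z
      rw [hφ.slash_eq V hV.1, hV.2]; simp
    have h1 : ModularGroup.S * ModularGroup.T ^ (N : ℤ) = V * ModularGroup.S := by
      ext i j
      rw [mul_apply_eq, mul_apply_eq, ModularGroup.coe_T_zpow]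
      fin_cases i <;> fin_cases j <;> simp [V, ModularGroup.S]
    have h2 := jacobiSlash_mul k p φ ModularGroup.S (ModularGroup.T ^ (N : ℤ))
    rw [h1, jacobiSlash_mul, hφV] at h2
    have h3 := congrFun (congrFun h2 τ) z
    rw [jacobiSlash_T_zpow] at h3
    exact h3.symm
  have hshift : ∀ (ν : ZMod (2 * p)) (τ : ℍ), e ((N : ℤ) * (ν.val : ℂ) ^ 2 / (4 * p)) *
      g ν (ModularGroup.T ^ (N : ℤ) • τ) = g ν τ := fun ν τ =>
    component_add_int hg (coe_T_zpow_smul (N : ℤ) τ) (hFN τ) ν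
  -- the components of `φ | S` vanish for an exponent that is not constant modulo `4 p`
  have hvanish : ∀ ν : ZMod (2 * p), (∀ n : ℤ,
      (N : ℂ) * ((ν + 2).val : ℂ) ^ 2 / (4 * p) ≠ N * (ν.val : ℂ) ^ 2 / (4 * p) + n) →
      ∀ τ, g ν τ = 0 := by
    intro ν hν τ
    have h1 := hshift ν τ
    have h2 := hshift (ν + 2) τ
    rw [hper, hper, ← h1] at h2
    by_contra hne
    have hne' : g ν (ModularGroup.T ^ (N : ℤ) • τ) ≠ 0 := by
      intro hz; rw [hz, mul_zero] at h1; exact hne h1.symm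
    have h3 := mul_right_cancel₀ hne' h2
    have h4 : e ((N : ℤ) * ((ν + 2).val : ℂ) ^ 2 / (4 * p) -
        (N : ℤ) * (ν.val : ℂ) ^ 2 / (4 * p)) = 1 := by
      rw [sub_eq_add_neg, e_add, e_neg, h3, mul_inv_cancel₀ (e_ne_zero _)]
    obtain ⟨n, hn⟩ := (e_eq_one_iff _).mp h4
    refine hν n ?_
    rw [Int.cast_natCast] at hn
    linear_combination hn
  have hndvd : ∀ x : ℕ, x.Coprime p → ∀ n : ℤ, (N : ℤ) * x ≠ p * n := by
    intro x hx n hn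
    have h1 : (p : ℤ) ∣ ((N * x : ℕ) : ℤ) := ⟨n, by push_cast; exact hn⟩
    rw [Int.natCast_dvd_natCast] at h1
    have h2 : p.Coprime (N * x) := hN.mul_right hx.symm
    have := Nat.Coprime.eq_one_of_dvd h2 h1
    omega
  -- Comparing the indices `0` and `2`, the exponents differ by `4N/(4p) = N/p`; below, `1` and `3`
  -- give `8N/(4p) = 2N/p`. Neither is an integer, and period `2` carries the vanishing to every
  -- index.
  have hg0 : ∀ τ, g 0 τ = 0 := by
    refine hvanish 0 fun n hn => ?_
    have hv : ((0 + 2 : ZMod (2 * p))).val = 2 := by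
      rw [zero_add]
      exact_mod_cast ZMod.val_natCast_of_lt (n := 2 * p) (a := 2) (by omega)
    rw [hv, ZMod.val_zero] at hn
    refine hndvd 1 (Nat.coprime_one_left p) n ?_
    have : (N : ℂ) = p * n := by
      field_simp at hn
      push_cast at hn
      linear_combination (1 / 4 : ℂ) * hn
    rw [Nat.cast_one, mul_one]
    exact_mod_cast this
  have hg1 : ∀ τ, g 1 τ = 0 := by
    refine hvanish 1 fun n hn => ?_
    have hv : ((1 + 2 : ZMod (2 * p))).val = 3 := by
      rw [show (1 + 2 : ZMod (2 * p)) = ((3 : ℕ) : ZMod (2 * p)) by push_cast; norm_num]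
      exact ZMod.val_natCast_of_lt (n := 2 * p) (a := 3) (by omega)
    have hv1 : (1 : ZMod (2 * p)).val = 1 := by
      exact_mod_cast ZMod.val_natCast_of_lt (n := 2 * p) (a := 1) (by omega)
    rw [hv, hv1] at hn
    refine hndvd 2 ((Nat.coprime_primes Nat.prime_two hpp).mpr hp.symm) n ?_
    have : (N : ℂ) * 2 = p * n := by
      field_simp at hn
      push_cast at hn
      linear_combination (1 / 4 : ℂ) * hn
    exact_mod_cast this
  have hgnat : ∀ n : ℕ, ∀ τ, g (n : ZMod (2 * p)) τ = 0 := by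
    intro n
    induction n using Nat.twoStepInduction with
    | zero => simpa using hg0
    | one => simpa using hg1
    | more n h1 _ =>
      intro τ
      push_cast
      rw [hper]
      exact h1 τ
  have hF0 : F = 0 := by
    funext τ z
    rw [hg τ z]
    refine Finset.sum_eq_zero fun ν _ => ?_
    have := hgnat ν.val τ
    rw [ZMod.natCast_zmod_val] at this
    rw [this, zero_mul]
  have h1 := jacobiSlash_mul k p φ ModularGroup.S ModularGroup.S⁻¹
  rw [mul_inv_cancel, jacobiSlash_one] at h1
  rw [h1]
  change jacobiSlash k p F _ = 0
  rw [hF0]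
  funext τ z
  simp [jacobiSlash_eq]

end EichlerZagier

/-! ### The proposition. -/

theorem proposition4p3 (k : ℤ) (p N : ℕ) [Fact p.Prime] (hp : p ≠ 2)
    (hN : Nat.Coprime (2 * p) N) (χ : DirichletCharacter ℂ N)
    (φ : ℍ → ℂ → ℂ) (hφ : EichlerZagier.IsJacobiForm k p N χ φ) (hφ0 : φ ≠ 0) :
    (∃! h : ZMod (2 * p) → ℍ → ℂ, EichlerZagier.IsThetaDecomposition p φ h) ∧
    ∀ h : ZMod (2 * p) → ℍ → ℂ, EichlerZagier.IsThetaDecomposition p φ h →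
      ∀ (f : ℕ) (_ : f = 1 ∨ f = p) (ε : DirichletCharacter ℂ f) (_ : ε.IsPrimitive),
        EichlerZagier.IsHalfIntegralModularForm (2 * k - 1) (4 * p * N * f)
          (EichlerZagier.nebentypus k p χ ε) (EichlerZagier.twistedEZ p ε h) ∧
        (EichlerZagier.IsJacobiCuspForm k p N χ φ →
          EichlerZagier.IsHalfIntegralCuspForm (2 * k - 1) (4 * p * N * f)
            (EichlerZagier.nebentypus k p χ ε) (EichlerZagier.twistedEZ p ε h)) ∧
        (EichlerZagier.twistedEZ p ε h ≠ 0 ↔ ε (-1) = χ (-1) * (-1 : ℂ) ^ k) := by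
  have hpp : p.Prime := Fact.out
  have : NeZero N := ⟨by
    rintro rfl
    have := Nat.coprime_zero_right (2 * p) |>.mp hN
    omega⟩
  constructor
  · obtain ⟨c, hc, -⟩ := hφ.expansion 1
    rw [EichlerZagier.jacobiSlash_one] at hc
    obtain ⟨h, hh⟩ := EichlerZagier.exists_thetaDecomposition hc fun τ z => by
      simpa using hφ.elliptic 1 0 τ z
    exact ⟨h, hh, fun g hg => hg.unique hh⟩
  · intro h hh f hf ε _
    have hfp : f ∣ p := by rcases hf with rfl | rfl <;> simp
    have hf2 : f ∣ 2 * p := hfp.mul_left 2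
    have : NeZero f := ⟨by
      rintro rfl
      exact hpp.ne_zero (zero_dvd_iff.mp hfp)⟩
    refine ⟨EichlerZagier.isHalfIntegralModularForm_twistedEZ hfp hφ hh ε,
      fun hcusp => EichlerZagier.isHalfIntegralCuspForm_twistedEZ hfp hcusp hh ε, ?_, ?_⟩
    · intro hne
      by_contra hpar
      exact hne (EichlerZagier.twistedEZ_eq_zero hf2 hφ hh hpar)
    · intro hpar h0
      refine hφ0 (EichlerZagier.eq_zero_of_component_eq_zero hp
        (Nat.Coprime.coprime_dvd_left (Dvd.intro_left 2 rfl) hN) hφ hh fun ν hν τ => ?_)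
      have h1 := EichlerZagier.char_mul_component_eq_zero hp hf2 hφ hh hpar h0 ν τ
      -- An index prime to `p` is a unit modulo `f ∣ p`, so `ε` does not vanish there and the
      -- component itself must.
      refine (mul_eq_zero.mp h1).resolve_left (IsUnit.ne_zero (IsUnit.map ε ?_))
      rw [ZMod.cast_eq_val, ZMod.isUnit_iff_coprime]
      exact Nat.Coprime.coprime_dvd_right hfp ((Nat.Prime.coprime_iff_not_dvd hpp).mpr hν).symm
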